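/- For $d\ge 4$ identify $\mathbb{R}^d$ with the set of monic real polynomials $Q=x^d+\sum_{j=0}^{d-1}a_jx^j$ through the coefficient vectors $(a_{d-1},\ldots,a_0)$. Let $R_{3,d}\subset\mathbb{R}^d$ be the set of those $Q$ which have no multiple real root and all of whose coefficients $a_0,\ldots,a_{d-1}$ are non-zero; its components are its connected components. Let $\sigma_\bullet=(+,-,+,+,\ldots,+,+,-,+)$ be the sign pattern of length $d+1$ whose entries (the signs of the coefficients of $x^d,x^{d-1},\ldots,x^0$) are $-$ exactly for $x^{d-1}$ and $x^1$ and $+$ otherwise. Let $A(\sigma_\bullet,(2,d-4))\subset\mathbb{R}^d$ be the set of those $Q$ whose coefficients have the signs given by $\sigma_\bullet$ and which have exactly two positive roots, exactly $d-4$ negative roots, all of them simple, and exactly one pair of complex conjugate non-real roots. (1) For every $d\ge 6$, the set $A(\sigma_\bullet,(2,d-4))$ is non-empty and is the union of more than one connected component of $R_{3,d}$. Hence $A(\sigma_\bullet,(2,d-4))$ is not connected. (2) For $d=4$ and $d=5$, the sets $A(\sigma_\bullet,(2,0))$ and $A(\sigma_\bullet,(2,1))$, respectively, are connected (and non-empty).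 -/

import Mathlib

open Polynomial

noncomputable section

namespace RealPoly

/-- The monic polynomial `x ^ d + ∑ j < d, a j * x ^ j`. -/
def monicPoly {d : ℕ} (a : Fin d → ℝ) : ℝ[X] :=
  X ^ d + ∑ j : Fin d, C (a j) * X ^ (j : ℕ)

/-- The discriminant set: coefficient vectors whose polynomial has a multiple real root. -/
def discriminantSet (d : ℕ) : Set (Fin d → ℝ) :=
  {a | ∃ x : ℝ, 2 ≤ (monicPoly a).rootMultiplicity x}

/-- `R_{3,d}`: no multiple real root and no vanishing coefficient. -/
def R3 (d : ℕ) : Set (Fin d → ℝ) :=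
  {a | a ∉ discriminantSet d ∧ ∀ j, a j ≠ 0}

/-- The (connected) components of a subset `S` of a topological space. -/
def componentsOf {E : Type*} [TopologicalSpace E] (S : Set E) : Set (Set E) :=
  {K | ∃ x ∈ S, K = connectedComponentIn S x}

/-- The sign pattern `(+,-,+,+,…,+,+,-,+)` of length `d + 1`; the entry at `j` is the sign of the
coefficient of `x ^ j`. -/
def sigmaBullet (d : ℕ) : Fin (d + 1) → SignType :=
  fun j => if (j : ℕ) = 1 ∨ (j : ℕ) + 1 = d then -1 else 1

/-- The polynomial `Q` has the sign pattern `σ`. -/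
def HasSignPattern {d : ℕ} (Q : ℝ[X]) (σ : Fin (d + 1) → SignType) : Prop :=
  ∀ j : Fin (d + 1), SignType.sign (Q.coeff (j : ℕ)) = σ j

/-- `A(σ, (pos, neg))`: the polynomials with sign pattern `σ` having exactly `pos` positive and
exactly `neg` negative roots, all real roots being simple, and exactly one pair of complex
conjugate non-real roots. -/
def A {d : ℕ} (σ : Fin (d + 1) → SignType) (pos neg : ℕ) : Set (Fin d → ℝ) :=
  {a | HasSignPattern (monicPoly a) σ ∧
    {x : ℝ | 0 < x ∧ (monicPoly a).IsRoot x}.ncard = pos ∧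
    {x : ℝ | x < 0 ∧ (monicPoly a).IsRoot x}.ncard = neg ∧
    (∀ x : ℝ, (monicPoly a).IsRoot x → (monicPoly a).rootMultiplicity x = 1) ∧
    ∃ z : ℂ, 0 < z.im ∧
      {w : ℂ | w.im ≠ 0 ∧ aeval w (monicPoly a) = 0} = {z, (starRingEnd ℂ) z}}

end RealPoly

end

noncomputable section

namespace RealPoly

open Filter Topology

/-! A polynomial in `A` factors as $(x-\alpha)(x-\beta)(x-z)(x-\bar z)\prod_i(x+\gamma_i)$ with
$0<\alpha<\beta$, $\operatorname{Im} z>0$ and distinct $\gamma_i>0$. For $d\ge 6$ the set is cut in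
two by the sign of $|z|^2-\alpha\beta$.

The wall $|z|^2=\alpha\beta=\rho^2$ is never met (`norm_sq_ne_of_hasSignPattern`). On it the quartic
factor is $x^4-ux^3+vx^2-\rho^2ux+\rho^4$, which $x\mapsto\rho^2/x$ preserves up to scaling. The
signs of the coefficients of $x^{d-1}$ and $x^{d-2}$ force $\sum\gamma_i<2\rho$; by the symmetry,
those of $x^1$ and $x^2$ force $\rho^2\sum\gamma_i^{-1}<2\rho$. Hence
$\sum\gamma_i\sum\gamma_i^{-1}<4$, whereas Cauchy–Schwarz bounds this product below by $(d-4)^2\ge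
4$.

Each side is open (`isOpen_sideSet`) and relatively closed in `R3`
(`closure_sideSet_inter_R3_subset`), hence a union of components. Both are non-empty
(`sideSet_sigmaBullet_nonempty`): take one quadratic factor with tiny roots and one with huge roots,
and let either of them carry the real pair.

For $d=4,5$, fix the real roots and write the other factor as $x^2-tx+q$. All sign conditions are
affine in $(t,q)$ and $t^2<4q$ is convex, so the parameter set has convex non-empty fibres over a
connected base (`isPreconnected_of_fibers`). -/

/-! ### Coefficient vectors and monic polynomials -/

lemma coeff_monicPoly_lt {d : ℕ} (a : Fin d → ℝ) (j : Fin d) :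
    (monicPoly a).coeff (j : ℕ) = a j := by
  simp only [monicPoly, coeff_add, coeff_X_pow, finsetSum_coeff, coeff_C_mul]
  rw [if_neg j.2.ne, Finset.sum_eq_single j]
  · simp
  · intro i _ hi
    rw [if_neg (fun h => hi (Fin.ext h.symm))]
    simp
  · simp

lemma monic_monicPoly {d : ℕ} (a : Fin d → ℝ) : (monicPoly a).Monic :=
  monic_X_pow_add (degree_sum_fin_lt a)

lemma natDegree_monicPoly {d : ℕ} (a : Fin d → ℝ) : (monicPoly a).natDegree = d := by
  have : (monicPoly a).degree = d := by
    rw [monicPoly, degree_add_eq_left_of_degree_lt] <;> rw [degree_X_pow]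
    exact degree_sum_fin_lt a
  exact natDegree_eq_of_degree_eq_some this

lemma coeff_monicPoly_self {d : ℕ} (a : Fin d → ℝ) : (monicPoly a).coeff d = 1 := by
  have := (monic_monicPoly a).coeff_natDegree
  rwa [natDegree_monicPoly] at this

lemma monicPoly_injective {d : ℕ} : Function.Injective (monicPoly (d := d)) := by
  intro a b h
  funext j
  rw [← coeff_monicPoly_lt a j, ← coeff_monicPoly_lt b j, h]

lemma eq_monicPoly {d : ℕ} {P : ℝ[X]} (hP : P.Monic) (hd : P.natDegree = d) :
    P = monicPoly fun j : Fin d => P.coeff j := by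
  ext n
  rcases lt_trichotomy n d with h | h | h
  · exact (coeff_monicPoly_lt (fun j : Fin d => P.coeff j) ⟨n, h⟩).symm
  · subst h
    rw [coeff_monicPoly_self, ← hd, hP.coeff_natDegree]
  · rw [coeff_eq_zero_of_natDegree_lt (hd ▸ h),
      coeff_eq_zero_of_natDegree_lt ((natDegree_monicPoly _).trans_lt h)]

lemma aeval_monicPoly {d : ℕ} (a : Fin d → ℝ) (z : ℂ) :
    aeval z (monicPoly a) = z ^ d + ∑ j : Fin d, (a j : ℂ) * z ^ (j : ℕ) := by
  simp [monicPoly]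

lemma eval_monicPoly {d : ℕ} (a : Fin d → ℝ) (x : ℝ) :
    (monicPoly a).eval x = x ^ d + ∑ j : Fin d, a j * x ^ (j : ℕ) := by
  simp [monicPoly, eval_finsetSum]

lemma continuous_eval_monicPoly {d : ℕ} (x : ℝ) :
    Continuous fun a : Fin d → ℝ => (monicPoly a).eval x := by
  simp only [eval_monicPoly]
  fun_prop

lemma continuous_aeval_monicPoly {d : ℕ} (z : ℂ) :
    Continuous fun a : Fin d → ℝ => aeval z (monicPoly a) := by
  simp only [aeval_monicPoly]
  fun_prop

/-! ### Factorization through the roots, and `A` in terms of root parameters -/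

/-- The monic real quadratic with roots `z` and its conjugate. -/
def quad (z : ℂ) : ℝ[X] := X ^ 2 - C (2 * z.re) * X + C (‖z‖ ^ 2)

lemma natDegree_quad (z : ℂ) : (quad z).natDegree = 2 := by
  unfold quad; compute_degree!

lemma monic_quad (z : ℂ) : (quad z).Monic := by
  unfold quad; monicity!

lemma eval_quad (z : ℂ) (x : ℝ) : (quad z).eval x = (x - z.re) ^ 2 + z.im ^ 2 := by
  simp only [quad, eval_add, eval_sub, eval_mul, eval_pow, eval_X, eval_C, Complex.sq_norm,
    Complex.normSq_apply]
  ring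

lemma eval_quad_pos {z : ℂ} (hz : z.im ≠ 0) (x : ℝ) : 0 < (quad z).eval x := by
  rw [eval_quad]; positivity

lemma aeval_quad (z w : ℂ) : aeval w (quad z) = (w - z) * (w - (starRingEnd ℂ) z) := by
  have h : ((‖z‖ ^ 2 : ℝ) : ℂ) = z * (starRingEnd ℂ) z := by
    rw [Complex.mul_conj, Complex.normSq_eq_norm_sq]
  have h2 : ((2 * z.re : ℝ) : ℂ) = z + (starRingEnd ℂ) z := by
    rw [Complex.add_conj]
  simp only [quad, map_add, map_sub, map_mul, map_pow, aeval_X, aeval_C, Complex.coe_algebraMap]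
  push_cast at h h2 ⊢
  linear_combination h - w * h2

lemma quad_dvd {P : ℝ[X]} {z : ℂ} (h : aeval z P = 0) (hz : z.im ≠ 0) : quad z ∣ P :=
  P.quadratic_dvd_of_aeval_eq_zero_im_ne_zero h hz

/-- The quadratic has no real zero, so the linear factors divide the cofactor; the two sides are
then monic, one divides the other, and the degree leaves no room for a further factor. -/
lemma eq_quad_mul_prod {P : ℝ[X]} (hP : P.Monic) (S : Finset ℝ) (hS : ∀ r ∈ S, P.IsRoot r)
    {z : ℂ} (h : aeval z P = 0) (hz : z.im ≠ 0) (hd : P.natDegree ≤ S.card + 2) :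
    P = quad z * ∏ r ∈ S, (X - C r) := by
  obtain ⟨g, hg⟩ := quad_dvd h hz
  have hg0 : g ≠ 0 := by
    rintro rfl
    exact hP.ne_zero (by simpa using hg)
  have hdvd : ∏ r ∈ S, (X - C r) ∣ g := by
    have : (S.val.map fun r => X - C r).prod ∣ g := by
      rw [Multiset.prod_X_sub_C_dvd_iff_le_roots hg0, Finset.val_le_iff_val_subset]
      intro r hr
      rw [mem_roots hg0]
      have := hS r hr
      rw [hg, IsRoot.def, eval_mul] at this
      exact (mul_eq_zero.1 this).resolve_left (eval_quad_pos hz r).ne'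
    exact this
  have hm : (∏ r ∈ S, (X - C r)).Monic := monic_prod_of_monic _ _ fun r _ => monic_X_sub_C r
  refine eq_of_monic_of_dvd_of_natDegree_le ((monic_quad z).mul hm) hP ?_ ?_
  · rw [hg]; exact mul_dvd_mul_left _ hdvd
  · rw [(monic_quad z).natDegree_mul hm, natDegree_quad,
      natDegree_prod_of_monic _ _ fun r _ => monic_X_sub_C r]
    simpa [add_comm] using hd

/-- The monic polynomial with real roots `α`, `β`, `-γ i` and complex roots `z`, `conj z`. -/
def rootProd {m : ℕ} (α β : ℝ) (z : ℂ) (γ : Fin m → ℝ) : ℝ[X] :=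
  (X - C α) * (X - C β) * quad z * ∏ i, (X + C (γ i))

/-- Two positive roots, `m` negative ones, all simple, and a non-real pair. -/
structure Admissible {m : ℕ} (α β : ℝ) (z : ℂ) (γ : Fin m → ℝ) : Prop where
  pos : 0 < α
  lt : α < β
  im_pos : 0 < z.im
  neg : ∀ i, 0 < γ i
  inj : Function.Injective γ

/-- The real roots of `rootProd`. -/
def realRoots {m : ℕ} (α β : ℝ) (γ : Fin m → ℝ) : Finset ℝ :=
  {α, β} ∪ Finset.univ.image fun i => -γ i

section
variable {m : ℕ} {α β : ℝ} {z : ℂ} {γ : Fin m → ℝ}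

lemma mem_realRoots {x : ℝ} : x ∈ realRoots α β γ ↔ x = α ∨ x = β ∨ ∃ i, -γ i = x := by
  simp [realRoots]

lemma Admissible.disjoint (h : Admissible α β z γ) :
    Disjoint ({α, β} : Finset ℝ) (Finset.univ.image fun i => -γ i) := by
  rw [Finset.disjoint_left]
  intro x hx hx'
  obtain ⟨i, _, rfl⟩ := Finset.mem_image.1 hx'
  have := h.neg i
  have := h.pos
  have := h.lt
  simp only [Finset.mem_insert, Finset.mem_singleton] at hx
  rcases hx with hx | hx <;> linarith

lemma Admissible.card_realRoots (h : Admissible α β z γ) : (realRoots α β γ).card = m + 2 := by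
  rw [realRoots, Finset.card_union_of_disjoint h.disjoint, Finset.card_pair h.lt.ne,
    Finset.card_image_of_injective _ (fun i j hij => h.inj (neg_injective hij))]
  simp [add_comm]

lemma Admissible.rootProd_eq (h : Admissible α β z γ) :
    rootProd α β z γ = quad z * ∏ r ∈ realRoots α β γ, (X - C r) := by
  rw [realRoots, Finset.prod_union h.disjoint, Finset.prod_pair h.lt.ne,
    Finset.prod_image (fun i _ j _ hij => h.inj (neg_injective hij)), rootProd]
  simp only [map_neg, sub_neg_eq_add]
  ring

lemma monic_rootProd : (rootProd α β z γ).Monic :=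
  (((monic_X_sub_C α).mul (monic_X_sub_C β)).mul (monic_quad z)).mul
    (monic_prod_of_monic _ _ fun i _ => monic_X_add_C (γ i))

lemma natDegree_rootProd : (rootProd α β z γ).natDegree = m + 4 := by
  have h1 := (monic_X_sub_C α).mul (monic_X_sub_C β)
  have h2 := h1.mul (monic_quad z)
  rw [rootProd, h2.natDegree_mul (monic_prod_of_monic _ _ fun i _ => monic_X_add_C (γ i)),
    h1.natDegree_mul (monic_quad z), (monic_X_sub_C α).natDegree_mul (monic_X_sub_C β),
    natDegree_quad, natDegree_prod_of_monic _ _ fun i _ => monic_X_add_C (γ i)]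
  simp
  omega

lemma Admissible.eq_rootProd (h : Admissible α β z γ) {P : ℝ[X]} (hP : P.Monic)
    (hd : P.natDegree = m + 4) (hα : P.IsRoot α) (hβ : P.IsRoot β) (hz : aeval z P = 0)
    (hγ : ∀ i, P.IsRoot (-γ i)) : P = rootProd α β z γ := by
  rw [h.rootProd_eq]
  refine eq_quad_mul_prod hP _ ?_ hz h.im_pos.ne' (by rw [h.card_realRoots, hd])
  intro r hr
  rcases mem_realRoots.1 hr with rfl | rfl | ⟨i, rfl⟩
  exacts [hα, hβ, hγ i]

lemma Admissible.roots (h : Admissible α β z γ) :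
    (rootProd α β z γ).roots = (realRoots α β γ).val := by
  have hm : (∏ r ∈ realRoots α β γ, (X - C r)).Monic :=
    monic_prod_of_monic _ _ fun r _ => monic_X_sub_C r
  rw [h.rootProd_eq, roots_mul ((monic_quad z).mul hm).ne_zero, roots_prod_X_sub_C]
  have : (quad z).roots = 0 := by
    refine Multiset.eq_zero_of_forall_notMem fun r hr => ?_
    exact (eval_quad_pos h.im_pos.ne' r).ne' (isRoot_of_mem_roots hr)
  rw [this, zero_add]

lemma Admissible.isRoot_iff (h : Admissible α β z γ) {x : ℝ} :
    (rootProd α β z γ).IsRoot x ↔ x = α ∨ x = β ∨ ∃ i, -γ i = x := by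
  rw [← mem_realRoots, ← Finset.mem_val, ← h.roots, mem_roots monic_rootProd.ne_zero]

lemma Admissible.rootMultiplicity (h : Admissible α β z γ) {x : ℝ}
    (hx : (rootProd α β z γ).IsRoot x) : (rootProd α β z γ).rootMultiplicity x = 1 := by
  rw [← count_roots, h.roots, Multiset.count_eq_one_of_mem (Finset.nodup _)]
  rw [← h.roots, mem_roots monic_rootProd.ne_zero]
  exact hx

lemma aeval_rootProd (w : ℂ) : aeval w (rootProd α β z γ) =
    (w - α) * (w - β) * ((w - z) * (w - (starRingEnd ℂ) z)) * ∏ i, (w + γ i) := by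
  simp [rootProd, aeval_quad, map_prod]

lemma Admissible.aeval_eq_zero_iff (h : Admissible α β z γ) {w : ℂ} :
    w.im ≠ 0 ∧ aeval w (rootProd α β z γ) = 0 ↔ w = z ∨ w = (starRingEnd ℂ) z := by
  rw [aeval_rootProd]
  constructor
  · rintro ⟨hw, h0⟩
    have hr : ∀ r : ℝ, w - r ≠ 0 := fun r hr => hw (by
      have := congrArg Complex.im hr
      simpa using this)
    have hp : ∏ i, (w + γ i) ≠ 0 := Finset.prod_ne_zero_iff.2 fun i _ => by
      have := hr (-γ i)
      simpa using this
    simp only [mul_eq_zero, hr, hp, or_false, false_or] at h0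
    exact h0.imp sub_eq_zero.1 sub_eq_zero.1
  · rintro (rfl | rfl)
    · exact ⟨h.im_pos.ne', by simp⟩
    · exact ⟨by simpa using h.im_pos.ne', by simp⟩

end

/-- Membership in `A` is a sign pattern together with a factorization. -/
lemma mem_A_iff {m : ℕ} {σ : Fin (m + 4 + 1) → SignType} {a : Fin (m + 4) → ℝ} :
    a ∈ A σ 2 m ↔ HasSignPattern (monicPoly a) σ ∧ ∃ α β z, ∃ γ : Fin m → ℝ,
      Admissible α β z γ ∧ monicPoly a = rootProd α β z γ := by
  constructor
  · rintro ⟨hs, hp, hn, -, z, hz, hzs⟩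
    refine ⟨hs, ?_⟩
    have hP0 := (monic_monicPoly a).ne_zero
    obtain ⟨α, β, hαβ, hset⟩ : ∃ α β : ℝ, α < β ∧
        {x : ℝ | 0 < x ∧ (monicPoly a).IsRoot x} = {α, β} := by
      obtain ⟨x, y, hxy, h⟩ := Set.ncard_eq_two.1 hp
      rcases hxy.lt_or_gt with h' | h'
      · exact ⟨x, y, h', h⟩
      · exact ⟨y, x, h', h.trans (Set.pair_comm x y)⟩
    have hα : α ∈ {x : ℝ | 0 < x ∧ (monicPoly a).IsRoot x} := by rw [hset]; simp
    have hβ : β ∈ {x : ℝ | 0 < x ∧ (monicPoly a).IsRoot x} := by rw [hset]; simp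
    have hfin : {x : ℝ | x < 0 ∧ (monicPoly a).IsRoot x}.Finite :=
      (finite_setOfPred_isRoot hP0).subset fun x hx => hx.2
    have hcard : hfin.toFinset.card = m := by rw [← Set.ncard_eq_toFinset_card _ hfin, hn]
    -- Listing the negative roots in increasing order provides an injective indexing by `Fin m`.
    let e := hfin.toFinset.orderEmbOfFin hcard
    have he : ∀ i, e i < 0 ∧ (monicPoly a).IsRoot (e i) := fun i => by
      have := Finset.orderEmbOfFin_mem hfin.toFinset hcard i
      exact (hfin.mem_toFinset).1 this
    have hzz : z ∈ {w : ℂ | w.im ≠ 0 ∧ aeval w (monicPoly a) = 0} := by rw [hzs]; simp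
    have hadm : Admissible α β z (fun i => -e i) :=
      ⟨hα.1, hαβ, hz, fun i => neg_pos.2 (he i).1, fun i j hij => e.injective (neg_injective hij)⟩
    exact ⟨α, β, z, _, hadm, hadm.eq_rootProd (monic_monicPoly a) (natDegree_monicPoly a) hα.2 hβ.2
      hzz.2 fun i => by rw [neg_neg]; exact (he i).2⟩
  · rintro ⟨hs, α, β, z, γ, h, hP⟩
    refine ⟨hs, ?_, ?_, ?_, z, h.im_pos, ?_⟩
    · have : {x : ℝ | 0 < x ∧ (monicPoly a).IsRoot x} = {α, β} := by
        ext x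
        simp only [hP, h.isRoot_iff, Set.mem_ofPred_eq, Set.mem_insert_iff, Set.mem_singleton_iff]
        constructor
        · rintro ⟨hx, rfl | rfl | ⟨i, rfl⟩⟩
          · simp
          · simp
          · linarith [h.neg i]
        · rintro (rfl | rfl)
          · exact ⟨h.pos, by simp⟩
          · exact ⟨h.pos.trans h.lt, by simp⟩
      rw [this, Set.ncard_pair h.lt.ne]
    · have : {x : ℝ | x < 0 ∧ (monicPoly a).IsRoot x} = Set.range fun i => -γ i := by
        ext x
        simp only [hP, h.isRoot_iff, Set.mem_ofPred_eq, Set.mem_range]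
        constructor
        · rintro ⟨hx, rfl | rfl | hi⟩
          · linarith [h.pos]
          · linarith [h.pos, h.lt]
          · exact hi
        · rintro ⟨i, rfl⟩
          exact ⟨by linarith [h.neg i], by simp⟩
      rw [this, ← Set.image_univ,
        Set.ncard_image_of_injective _ (fun i j hij => h.inj (neg_injective hij))]
      simp
    · intro x hx
      rw [hP] at hx ⊢
      exact h.rootMultiplicity hx
    · ext w
      simp only [hP, h.aeval_eq_zero_iff, Set.mem_ofPred_eq, Set.mem_insert_iff,
        Set.mem_singleton_iff]

/-! ### Sign patterns: open, and closed away from vanishing coefficients -/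

lemma A_subset_R3 {d pos neg : ℕ} {σ : Fin (d + 1) → SignType} (hσ : ∀ j, σ j ≠ 0) :
    A (d := d) σ pos neg ⊆ R3 d := by
  rintro a ⟨hs, -, -, hr, -⟩
  refine ⟨?_, fun j hj => ?_⟩
  · rintro ⟨x, hx⟩
    have := hr x ((rootMultiplicity_pos (monic_monicPoly a).ne_zero).1 (by omega))
    omega
  · have := hs j.castSucc
    rw [Fin.val_castSucc, coeff_monicPoly_lt, hj, sign_zero] at this
    exact hσ _ this.symm

lemma isOpen_setOf_sign_eq {s : SignType} (hs : s ≠ 0) :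
    IsOpen {x : ℝ | SignType.sign x = s} := by
  cases s
  · exact absurd rfl hs
  · simpa only [SignType.neg_eq_neg_one, sign_eq_neg_one_iff] using! isOpen_Iio (a := (0 : ℝ))
  · simpa only [SignType.pos_eq_one, sign_eq_one_iff] using! isOpen_Ioi (a := (0 : ℝ))

lemma continuous_coeff_monicPoly {d : ℕ} (j : Fin (d + 1)) :
    Continuous fun a : Fin d → ℝ => (monicPoly a).coeff (j : ℕ) := by
  refine Fin.lastCases ?_ (fun i => ?_) j
  · simp only [Fin.val_last, coeff_monicPoly_self]
    exact continuous_const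
  · simp only [Fin.val_castSucc, coeff_monicPoly_lt]
    exact continuous_apply i

lemma isOpen_hasSignPattern {d : ℕ} {σ : Fin (d + 1) → SignType} (hσ : ∀ j, σ j ≠ 0) :
    IsOpen {a : Fin d → ℝ | HasSignPattern (monicPoly a) σ} := by
  have : {a : Fin d → ℝ | HasSignPattern (monicPoly a) σ} =
      ⋂ j : Fin (d + 1), (fun a : Fin d → ℝ => (monicPoly a).coeff (j : ℕ)) ⁻¹'
        {x : ℝ | SignType.sign x = σ j} := by
    ext a; simp [HasSignPattern]
  rw [this]
  exact isOpen_iInter_of_finite fun j =>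
    (isOpen_setOf_sign_eq (hσ j)).preimage (continuous_coeff_monicPoly j)

lemma sign_eq_of_mem_closure {s : SignType} {x : ℝ}
    (hx : x ∈ closure {x : ℝ | SignType.sign x = s}) (h0 : x ≠ 0) : SignType.sign x = s := by
  have hopen := isOpen_setOf_sign_eq (s := SignType.sign x) (by simpa using h0)
  obtain ⟨y, hy, hy'⟩ := mem_closure_iff.1 hx _ hopen rfl
  exact hy.symm.trans hy'

lemma hasSignPattern_of_mem_closure {d : ℕ} {σ : Fin (d + 1) → SignType} {a : Fin d → ℝ}
    (ha : a ∈ closure {a : Fin d → ℝ | HasSignPattern (monicPoly a) σ}) (h0 : ∀ j, a j ≠ 0) :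
    HasSignPattern (monicPoly a) σ := by
  intro j
  refine sign_eq_of_mem_closure ?_ ?_
  · exact map_mem_closure (f := fun a : Fin d → ℝ => (monicPoly a).coeff (j : ℕ))
      (continuous_coeff_monicPoly j) ha fun b hb => hb j
  · refine Fin.lastCases ?_ (fun i => ?_) j
    · simp [coeff_monicPoly_self]
    · simpa [coeff_monicPoly_lt] using h0 i

/-! ### Persistence of roots under perturbation -/

lemma eventually_exists_isRoot_near {d : ℕ} {a : Fin d → ℝ} {x : ℝ}
    (hx : (monicPoly a).rootMultiplicity x = 1) {ε : ℝ} (hε : 0 < ε) :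
    ∀ᶠ b in 𝓝 a, ∃ y, dist y x < ε ∧ (monicPoly b).IsRoot y := by
  obtain ⟨g, hg, hng⟩ :=
    exists_eq_pow_rootMultiplicity_mul_and_not_dvd (monicPoly a) (monic_monicPoly a).ne_zero x
  rw [hx, pow_one] at hg
  have hgx : g.eval x ≠ 0 := fun h => hng (dvd_iff_isRoot.2 h)
  have hpos : ∀ᶠ y in 𝓝 x, 0 < g.eval x * g.eval y := by
    have hc : Continuous fun y => g.eval x * g.eval y := by fun_prop
    exact hc.continuousAt.eventually (lt_mem_nhds (mul_self_pos.2 hgx))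
  obtain ⟨η, hη, hball⟩ := Metric.eventually_nhds_iff.1 hpos
  set δ := min (η / 2) (ε / 2) with hδ
  have hδ0 : 0 < δ := by positivity
  have hδη : δ < η := (min_le_left _ _).trans_lt (by linarith)
  have hδε : δ < ε := (min_le_right _ _).trans_lt (by linarith)
  have h1 := hball (y := x + δ) (by simpa [Real.dist_eq, abs_of_pos hδ0] using hδη)
  have h2 := hball (y := x - δ) (by simpa [Real.dist_eq, abs_of_pos hδ0] using hδη)
  -- At `x ± δ` the polynomial is `±δ` times a value of `g`, and `g` keeps the sign of `g.eval x`
  -- there. This strict sign change survives small perturbations.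
  have hneg : (monicPoly a).eval (x + δ) * (monicPoly a).eval (x - δ) < 0 := by
    have h3 : 0 < g.eval (x + δ) * g.eval (x - δ) := by
      have h4 := mul_pos h1 h2
      have h5 : 0 < g.eval x ^ 2 := by positivity
      refine pos_of_mul_pos_right (a := g.eval x ^ 2) ?_ h5.le
      linarith
    rw [hg]
    simp only [eval_mul, eval_sub, eval_X, eval_C]
    have h6 : 0 < δ ^ 2 * (g.eval (x + δ) * g.eval (x - δ)) := by positivity
    linarith
  have hc : Continuous fun b : Fin d → ℝ =>
      (monicPoly b).eval (x + δ) * (monicPoly b).eval (x - δ) :=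
    (continuous_eval_monicPoly _).mul (continuous_eval_monicPoly _)
  filter_upwards [hc.continuousAt.eventually (gt_mem_nhds hneg)] with b hb
  have hivt := intermediate_value_uIcc (a := x - δ) (b := x + δ)
    (f := fun y => (monicPoly b).eval y) (monicPoly b).continuous.continuousOn
  have h0 : (0 : ℝ) ∈ Set.uIcc ((monicPoly b).eval (x - δ)) ((monicPoly b).eval (x + δ)) := by
    rw [Set.mem_uIcc]
    rcases mul_neg_iff.1 hb with h | h
    · exact Or.inl ⟨h.2.le, h.1.le⟩
    · exact Or.inr ⟨h.1.le, h.2.le⟩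
  obtain ⟨y, hy, hy0⟩ := hivt h0
  refine ⟨y, ?_, hy0⟩
  rw [Set.uIcc_of_le (by linarith)] at hy
  rw [Real.dist_eq, abs_lt]
  constructor <;> linarith [hy.1, hy.2]

lemma pow_card_le_norm_prod {z : ℂ} {ε : ℝ} (hε : 0 < ε) {s : Multiset ℂ}
    (h : ∀ w ∈ s, ε ≤ ‖z - w‖) : ε ^ s.card ≤ ‖(s.map fun w => z - w).prod‖ := by
  induction s using Multiset.induction_on with
  | empty => simp
  | cons w s ih =>
    rw [Multiset.card_cons, pow_succ', Multiset.map_cons, Multiset.prod_cons, norm_mul]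
    exact mul_le_mul (h w (Multiset.mem_cons_self w s))
      (ih fun v hv => h v (Multiset.mem_cons_of_mem hv)) (by positivity) (norm_nonneg _)

/-- The value at `z` is the product of the differences between `z` and the complex roots; if all of
them had norm at least `ε`, so large a product could not be below `ε ^ P.natDegree`. -/
lemma exists_root_near_of_norm_aeval_lt {P : ℝ[X]} (hP : P.Monic) {z : ℂ} {ε : ℝ} (hε : 0 < ε)
    (h : ‖aeval z P‖ < ε ^ P.natDegree) : ∃ w, dist w z < ε ∧ aeval w P = 0 := by
  by_contra! hcon
  have hm : (P.map (algebraMap ℝ ℂ)).Monic := hP.map _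
  have hs := IsAlgClosed.splits (P.map (algebraMap ℝ ℂ))
  have hcard := hs.natDegree_eq_card_roots
  have heval := hs.eval_eq_prod_roots_of_monic hm z
  rw [eval_map_algebraMap] at heval
  rw [heval] at h
  refine absurd h (not_lt.2 ?_)
  rw [natDegree_map] at hcard
  rw [hcard]
  refine pow_card_le_norm_prod hε fun w hw => ?_
  rw [← dist_eq_norm, dist_comm]
  by_contra! hlt
  refine hcon w hlt ?_
  rw [← eval_map_algebraMap]
  exact isRoot_of_mem_roots hw

/-! ### The two sides of the wall: openness -/

/-- The parameters `(α, β, z, γ)` of `rootProd`. -/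
abbrev Params (m : ℕ) : Type := ℝ × ℝ × ℂ × (Fin m → ℝ)

/-- The admissible parameters for which `‖z‖ ^ 2 - α * β` has the sign of `c`. -/
def sideParams (m : ℕ) (c : ℝ) : Set (Params m) :=
  {p | Admissible p.1 p.2.1 p.2.2.1 p.2.2.2 ∧ 0 < c * (‖p.2.2.1‖ ^ 2 - p.1 * p.2.1)}

lemma isOpen_sideParams (m : ℕ) (c : ℝ) : IsOpen (sideParams m c) := by
  have : sideParams m c = {p | 0 < p.1} ∩ {p | p.1 < p.2.1} ∩ {p | 0 < p.2.2.1.im} ∩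
      (⋂ i, {p | 0 < p.2.2.2 i}) ∩ (⋂ i, ⋂ j, {p | i ≠ j → p.2.2.2 i ≠ p.2.2.2 j}) ∩
      {p | 0 < c * (‖p.2.2.1‖ ^ 2 - p.1 * p.2.1)} := by
    ext p
    simp only [sideParams, Set.mem_inter_iff, Set.mem_iInter, Set.mem_ofPred_eq]
    constructor
    · rintro ⟨⟨h1, h2, h3, h4, h5⟩, h6⟩
      exact ⟨⟨⟨⟨⟨h1, h2⟩, h3⟩, h4⟩, fun i j hij => h5.ne hij⟩, h6⟩
    · rintro ⟨⟨⟨⟨⟨h1, h2⟩, h3⟩, h4⟩, h5⟩, h6⟩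
      exact ⟨⟨h1, h2, h3, h4, fun i j hij => by_contra fun hne => h5 i j hne hij⟩, h6⟩
  rw [this]
  refine ((((IsOpen.inter ?_ ?_).inter ?_).inter ?_).inter ?_).inter ?_
  · exact isOpen_lt continuous_const (by fun_prop)
  · exact isOpen_lt (by fun_prop) (by fun_prop)
  · exact isOpen_lt continuous_const (Complex.continuous_im.comp (by fun_prop))
  · exact isOpen_iInter_of_finite fun i => isOpen_lt continuous_const (by fun_prop)
  · refine isOpen_iInter_of_finite fun i => isOpen_iInter_of_finite fun j => ?_
    by_cases hij : i = j
    · simp [hij]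
    · simp only [ne_eq, hij, not_false_eq_true, forall_const]
      exact isOpen_ne_fun (by fun_prop) (by fun_prop)
  · exact isOpen_lt continuous_const (by fun_prop)

/-- The polynomials with sign pattern `σ` and root parameters in `sideParams m c`. -/
def sideSet {m : ℕ} (σ : Fin (m + 4 + 1) → SignType) (c : ℝ) : Set (Fin (m + 4) → ℝ) :=
  {a | HasSignPattern (monicPoly a) σ ∧
    ∃ p ∈ sideParams m c, monicPoly a = rootProd p.1 p.2.1 p.2.2.1 p.2.2.2}

lemma sideSet_subset_A {m : ℕ} {σ : Fin (m + 4 + 1) → SignType} {c : ℝ} :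
    sideSet σ c ⊆ A σ 2 m := by
  rintro a ⟨hs, p, hp, h⟩
  exact mem_A_iff.2 ⟨hs, _, _, _, _, hp.1, h⟩

/-- The roots found near those of `a` form a parameter point in the open set `sideParams m c`; being
distinct, they exhaust the degree and give the whole factorization. -/
lemma isOpen_sideSet {m : ℕ} {σ : Fin (m + 4 + 1) → SignType} (hσ : ∀ j, σ j ≠ 0) (c : ℝ) :
    IsOpen (sideSet σ c) := by
  rw [isOpen_iff_mem_nhds]
  rintro a ⟨hs, p, hp, hP⟩
  obtain ⟨ε, hε, hball⟩ := Metric.isOpen_iff.1 (isOpen_sideParams m c) p hp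
  have hroot : ∀ x, (x = p.1 ∨ x = p.2.1 ∨ ∃ i, -p.2.2.2 i = x) →
      (monicPoly a).rootMultiplicity x = 1 := fun x hx => by
    rw [hP]; exact hp.1.rootMultiplicity (hp.1.isRoot_iff.2 hx)
  have hz : aeval p.2.2.1 (monicPoly a) = 0 := by
    rw [hP]; exact (hp.1.aeval_eq_zero_iff.2 (Or.inl rfl)).2
  have hcz : ∀ᶠ b in 𝓝 a, ‖aeval p.2.2.1 (monicPoly b)‖ < ε ^ (m + 4) := by
    have hc := (continuous_aeval_monicPoly (d := m + 4) p.2.2.1).norm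
    refine hc.continuousAt.eventually (gt_mem_nhds ?_)
    simp only [hz, norm_zero]; positivity
  filter_upwards [(isOpen_hasSignPattern hσ).mem_nhds hs,
    eventually_exists_isRoot_near (hroot p.1 (by simp)) hε,
    eventually_exists_isRoot_near (hroot p.2.1 (by simp)) hε, hcz,
    eventually_all.2 fun i => eventually_exists_isRoot_near (hroot (-p.2.2.2 i) (by simp)) hε]
    with b hb ⟨α, hα, hα0⟩ ⟨β, hβ, hβ0⟩ hw hγ
  obtain ⟨w, hwz, hw0⟩ := exists_root_near_of_norm_aeval_lt (monic_monicPoly b) hε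
    (by rwa [natDegree_monicPoly])
  choose y hy hy0 using hγ
  have hmem : (α, β, w, fun i => -y i) ∈ sideParams m c := by
    refine hball ?_
    simp only [Metric.mem_ball, Prod.dist_eq, max_lt_iff]
    refine ⟨hα, hβ, hwz, (dist_pi_lt_iff hε).2 fun i => ?_⟩
    have := hy i
    rwa [← dist_neg_neg, neg_neg]
  refine ⟨hb, _, hmem, hmem.1.eq_rootProd (monic_monicPoly b) (natDegree_monicPoly b) hα0 hβ0 hw0
    fun i => ?_⟩
  simpa using hy0 i

/-! ### Limits of factorizations -/

lemma norm_le_of_aeval_monicPoly_eq_zero {d : ℕ} {a : Fin d → ℝ} {z : ℂ}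
    (h : aeval z (monicPoly a) = 0) : ‖z‖ ≤ 1 + ∑ j, |a j| := by
  by_contra! hlt
  have h0 : 0 ≤ ∑ j, |a j| := Finset.sum_nonneg fun j _ => abs_nonneg _
  have h1 : 1 < ‖z‖ := by linarith
  rw [aeval_monicPoly] at h
  have h2 : ‖z‖ ^ d ≤ ∑ j : Fin d, |a j| * ‖z‖ ^ (j : ℕ) := by
    rw [← norm_pow, eq_neg_of_add_eq_zero_left h, norm_neg]
    refine (norm_sum_le _ _).trans (le_of_eq ?_)
    simp
  obtain _ | d := d
  · norm_num at h2
  have h3 : ∑ j : Fin (d + 1), |a j| * ‖z‖ ^ (j : ℕ) ≤ ∑ j : Fin (d + 1), |a j| * ‖z‖ ^ d := by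
    refine Finset.sum_le_sum fun j _ => mul_le_mul_of_nonneg_left ?_ (abs_nonneg _)
    exact pow_le_pow_right₀ h1.le (by omega)
  rw [← Finset.sum_mul] at h3
  have h4 : ‖z‖ ^ d * ‖z‖ ≤ ‖z‖ ^ d * ∑ j, |a j| := by
    rw [← pow_succ, mul_comm]; exact h2.trans h3
  have := le_of_mul_le_mul_left h4 (by positivity)
  linarith

lemma abs_le_of_isRoot_monicPoly {d : ℕ} {a : Fin d → ℝ} {x : ℝ}
    (h : (monicPoly a).IsRoot x) : |x| ≤ 1 + ∑ j, |a j| := by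
  have : aeval (x : ℂ) (monicPoly a) = 0 := by
    rw [← Complex.coe_algebraMap, aeval_algebraMap_apply, coe_aeval_eq_eval, h.eq_zero, map_zero]
  simpa using norm_le_of_aeval_monicPoly_eq_zero this

lemma norm_params_le {m : ℕ} {a : Fin (m + 4) → ℝ} {p : Params m}
    (h : Admissible p.1 p.2.1 p.2.2.1 p.2.2.2)
    (hP : monicPoly a = rootProd p.1 p.2.1 p.2.2.1 p.2.2.2) : ‖p‖ ≤ 1 + ∑ j, |a j| := by
  have h0 : 0 ≤ 1 + ∑ j, |a j| := add_nonneg zero_le_one (Finset.sum_nonneg fun j _ => abs_nonneg _)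
  simp only [Prod.norm_def, max_le_iff, Real.norm_eq_abs]
  refine ⟨abs_le_of_isRoot_monicPoly ?_, abs_le_of_isRoot_monicPoly ?_,
    norm_le_of_aeval_monicPoly_eq_zero ?_, (pi_norm_le_iff_of_nonneg h0).2 fun i => ?_⟩
  · rw [hP, h.isRoot_iff]; simp
  · rw [hP, h.isRoot_iff]; simp
  · rw [hP]; exact (h.aeval_eq_zero_iff.2 (Or.inl rfl)).2
  · rw [Real.norm_eq_abs, ← abs_neg]
    refine abs_le_of_isRoot_monicPoly ?_
    rw [hP, h.isRoot_iff]; simp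

lemma eval_rootProd {m : ℕ} (α β : ℝ) (z : ℂ) (γ : Fin m → ℝ) (x : ℝ) :
    (rootProd α β z γ).eval x =
      (x - α) * (x - β) * ((x - z.re) ^ 2 + z.im ^ 2) * ∏ i, (x + γ i) := by
  simp [rootProd, eval_quad, eval_prod]

lemma continuous_eval_rootProd {m : ℕ} (x : ℝ) :
    Continuous fun p : Params m => (rootProd p.1 p.2.1 p.2.2.1 p.2.2.2).eval x := by
  simp only [eval_rootProd]
  have h1 : Continuous fun p : Params m => p.2.2.1.re := Complex.continuous_re.comp (by fun_prop)
  have h2 : Continuous fun p : Params m => p.2.2.1.im := Complex.continuous_im.comp (by fun_prop)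
  fun_prop

/-- Cauchy's root bound keeps the parameters of a convergent sequence of polynomials in a fixed
ball, so a subsequence converges and the factorization passes to the limit. -/
lemma exists_params_of_mem_closure {m : ℕ} {σ : Fin (m + 4 + 1) → SignType} {c : ℝ}
    {a : Fin (m + 4) → ℝ} (ha : a ∈ closure (sideSet σ c)) :
    ∃ p ∈ closure (sideParams m c), monicPoly a = rootProd p.1 p.2.1 p.2.2.1 p.2.2.2 := by
  obtain ⟨b, hb, hba⟩ := mem_closure_iff_seq_limit.1 ha
  choose hs p hp hP using hb
  have hc : Continuous fun a : Fin (m + 4) → ℝ => 1 + ∑ j, |a j| := by fun_prop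
  obtain ⟨B, hB⟩ := ((hc.tendsto a).comp hba).bddAbove_range
  have hbdd : Bornology.IsBounded (Metric.closedBall (0 : Params m) B) :=
    Metric.isBounded_closedBall
  obtain ⟨q, -, φ, hφ, hq⟩ := tendsto_subseq_of_bounded hbdd (x := p) fun n => by
    rw [mem_closedBall_zero_iff]
    exact (norm_params_le (hp n).1 (hP n)).trans (hB ⟨n, rfl⟩)
  refine ⟨q, mem_closure_of_tendsto hq (Eventually.of_forall fun n => hp _), ?_⟩
  refine Polynomial.funext fun x => ?_
  have h1 := ((continuous_eval_monicPoly x).tendsto a).comp (hba.comp hφ.tendsto_atTop)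
  have h2 := ((continuous_eval_rootProd x).tendsto q).comp hq
  refine tendsto_nhds_unique h1 (h2.congr fun n => ?_)
  simp [hP]

/-- A limit can degenerate only by a root reaching 0, which kills the constant coefficient, or by
two roots merging, which creates a multiple real root. Both are excluded in `R3`. -/
lemma admissible_of_mem_closure {m : ℕ} {c : ℝ} {a : Fin (m + 4) → ℝ} (ha : a ∈ R3 (m + 4))
    {p : Params m} (hp : p ∈ closure (sideParams m c))
    (hP : monicPoly a = rootProd p.1 p.2.1 p.2.2.1 p.2.2.2) :
    Admissible p.1 p.2.1 p.2.2.1 p.2.2.2 ∧ 0 ≤ c * (‖p.2.2.1‖ ^ 2 - p.1 * p.2.1) := by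
  have hclosed : ∀ {f : Params m → ℝ}, Continuous f → (∀ q ∈ sideParams m c, 0 ≤ f q) → 0 ≤ f p :=
    fun hf h => closure_minimal h (isClosed_le continuous_const hf) hp
  have hα := hclosed (f := fun q => q.1) (by fun_prop) fun q hq => hq.1.pos.le
  have hαβ := hclosed (f := fun q => q.2.1 - q.1) (by fun_prop) fun q hq => sub_nonneg.2 hq.1.lt.le
  have him := hclosed (f := fun q => q.2.2.1.im) (Complex.continuous_im.comp (by fun_prop))
    fun q hq => hq.1.im_pos.le
  have hγ := fun i => hclosed (f := fun q => q.2.2.2 i) (by fun_prop) fun q hq => (hq.1.neg i).le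
  have hside := hclosed (f := fun q => c * (‖q.2.2.1‖ ^ 2 - q.1 * q.2.1)) (by fun_prop)
    fun q hq => hq.2.le
  have h0 : (rootProd p.1 p.2.1 p.2.2.1 p.2.2.2).eval 0 ≠ 0 := by
    rw [← hP, ← coeff_zero_eq_eval_zero]
    have := coeff_monicPoly_lt a ⟨0, by omega⟩
    simp only at this
    rw [this]
    exact ha.2 _
  rw [eval_rootProd] at h0
  have hprod := (mul_ne_zero_iff.1 h0).2
  have hα0 : p.1 ≠ 0 := fun h => h0 (by simp [h])
  have hmult : ∀ x, ¬ (X - C x) ^ 2 ∣ rootProd p.1 p.2.1 p.2.2.1 p.2.2.2 := fun x hx =>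
    ha.1 ⟨x, (le_rootMultiplicity_iff (monic_monicPoly a).ne_zero).2 (hP ▸ hx)⟩
  refine ⟨⟨hα.lt_of_ne' hα0, (sub_nonneg.1 hαβ).lt_of_ne fun h => ?_, him.lt_of_ne' fun h => ?_,
    fun i => (hγ i).lt_of_ne' fun h => ?_, fun i j hij => by_contra fun hne => ?_⟩, hside⟩
  · refine hmult p.1 ?_
    rw [rootProd, ← h, sq, mul_assoc _ (quad _)]
    exact dvd_mul_right _ _
  · refine hmult p.2.2.1.re ?_
    -- When the conjugate pair reaches the real axis it becomes a double real root.
    have : quad p.2.2.1 = (X - C p.2.2.1.re) ^ 2 := by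
      refine Polynomial.funext fun x => ?_
      rw [eval_quad, show p.2.2.1.im = 0 from h]
      simp
    rw [rootProd, this]
    exact Dvd.dvd.mul_right (dvd_mul_left _ _) _
  · have := Finset.prod_ne_zero_iff.1 hprod i (Finset.mem_univ i)
    exact this (by simpa using h)
  · refine hmult (-p.2.2.2 i) ?_
    rw [rootProd, ← Finset.mul_prod_erase _ _ (Finset.mem_univ i),
      ← Finset.mul_prod_erase (Finset.univ.erase i) (fun k => X + C (p.2.2.2 k))
        (Finset.mem_erase.2 ⟨Ne.symm hne, Finset.mem_univ j⟩), ← hij, map_neg, sub_neg_eq_add, sq,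
      ← mul_assoc (X + C (p.2.2.2 i))]
    exact Dvd.dvd.mul_left (dvd_mul_right _ _) _

/-! ### Coefficients of a quartic times a product of negative-root factors -/

lemma sigmaBullet_ne_zero {d : ℕ} (j : Fin (d + 1)) : sigmaBullet d j ≠ 0 := by
  unfold sigmaBullet; split_ifs <;> decide

lemma coeff_quartic_mul (R : ℝ[X]) (c₄ c₃ c₂ c₁ c₀ : ℝ) (j : ℕ) :
    ((C c₄ * X ^ 4 + C c₃ * X ^ 3 + C c₂ * X ^ 2 + C c₁ * X + C c₀) * R).coeff (j + 4) =
      c₄ * R.coeff j + c₃ * R.coeff (j + 1) + c₂ * R.coeff (j + 2) + c₁ * R.coeff (j + 3) +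
        c₀ * R.coeff (j + 4) := by
  have h3 : (X ^ 3 * R).coeff (j + 4) = R.coeff (j + 1) := coeff_X_pow_mul R 3 (j + 1)
  have h2 : (X ^ 2 * R).coeff (j + 4) = R.coeff (j + 2) := coeff_X_pow_mul R 2 (j + 2)
  have h1 : (X * R).coeff (j + 4) = R.coeff (j + 3) := coeff_X_mul R (j + 3)
  simp only [add_mul, mul_assoc, coeff_add, coeff_C_mul, coeff_X_pow_mul, h3, h2, h1]

lemma coeff_quartic_mul_low (R : ℝ[X]) (c₄ c₃ c₂ c₁ c₀ : ℝ) :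
    let Q := (C c₄ * X ^ 4 + C c₃ * X ^ 3 + C c₂ * X ^ 2 + C c₁ * X + C c₀) * R
    Q.coeff 0 = c₀ * R.coeff 0 ∧ Q.coeff 1 = c₁ * R.coeff 0 + c₀ * R.coeff 1 ∧
    Q.coeff 2 = c₂ * R.coeff 0 + c₁ * R.coeff 1 + c₀ * R.coeff 2 ∧
    Q.coeff 3 = c₃ * R.coeff 0 + c₂ * R.coeff 1 + c₁ * R.coeff 2 + c₀ * R.coeff 3 := by
  have h1 : ∀ n, (X * R).coeff (n + 1) = R.coeff n := fun n => coeff_X_mul R n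
  refine ⟨?_, ?_, ?_, ?_⟩ <;>
    simp [add_mul, mul_assoc, coeff_X_pow_mul', h1 0, h1 1, h1 2]

section
variable {ι : Type*} {γ : ι → ℝ} {s : Finset ι}

lemma coeff_one_prod_X_add_C (h : ∀ i, 0 < γ i) : (∏ i ∈ s, (X + C (γ i))).coeff 1 =
    (∏ i ∈ s, (X + C (γ i))).coeff 0 * ∑ i ∈ s, (γ i)⁻¹ := by
  classical
  induction s using Finset.induction_on with
  | empty => simp [coeff_one]
  | insert i s hi ih =>
    have := (h i).ne'
    rw [Finset.prod_insert hi, Finset.sum_insert hi]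
    simp only [add_mul, coeff_add, coeff_X_mul, coeff_C_mul, ih, mul_coeff_zero, coeff_X_zero,
      zero_mul, zero_add, coeff_add, coeff_C_zero]
    field_simp

/-- A Newton-type inequality: adjoining a factor multiplies the gap between the two sides by `γ i ^
2` and adds a square. -/
lemma coeff_two_prod_X_add_C_le :
    2 * (∏ i ∈ s, (X + C (γ i))).coeff 2 * (∏ i ∈ s, (X + C (γ i))).coeff 0 ≤
      (∏ i ∈ s, (X + C (γ i))).coeff 1 ^ 2 := by
  classical
  induction s using Finset.induction_on with
  | empty => simp [coeff_one]
  | insert i s hi ih =>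
    rw [Finset.prod_insert hi]
    set R := ∏ i ∈ s, (X + C (γ i))
    have h1 : (X * R).coeff 2 = R.coeff 1 := coeff_X_mul R 1
    have h2 : (X * R).coeff 1 = R.coeff 0 := coeff_X_mul R 0
    simp only [add_mul, coeff_add, coeff_C_mul, coeff_zero_eq_eval_zero (X * R), eval_mul, eval_X,
      zero_mul, zero_add, h1, h2]
    nlinarith [mul_le_mul_of_nonneg_left ih (sq_nonneg (γ i)), sq_nonneg (R.coeff 0)]

lemma coeff_prod_X_add_C_pos (h : ∀ i, 0 < γ i) {j : ℕ} (hj : j ≤ s.card) :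
    0 < (∏ i ∈ s, (X + C (γ i))).coeff j := by
  classical
  induction s using Finset.induction_on generalizing j with
  | empty =>
    obtain rfl : j = 0 := by simpa using hj
    simp
  | insert i s hi ih =>
    rw [Finset.card_insert_of_notMem hi] at hj
    rw [Finset.prod_insert hi]
    obtain _ | j := j
    · simpa [coeff_zero_eq_eval_zero (_ * _), ← coeff_zero_eq_eval_zero] using
        mul_pos (h i) (ih (Nat.zero_le _))
    · simp only [add_mul, coeff_add, coeff_X_mul, coeff_C_mul]
      have h1 := ih (j := j) (by omega)
      rcases (show j + 1 ≤ s.card ∨ s.card < j + 1 by omega) with h2 | h2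
      · have := mul_pos (h i) (ih h2)
        linarith
      · rw [coeff_eq_zero_of_natDegree_lt (n := j + 1)]
        · simpa using h1
        · rw [natDegree_prod_of_monic _ _ fun i _ => monic_X_add_C (γ i)]
          simpa using h2

lemma natDegree_prod_X_add_C : (∏ i ∈ s, (X + C (γ i))).natDegree = s.card := by
  rw [natDegree_prod_of_monic _ _ fun i _ => monic_X_add_C (γ i)]
  simp

lemma coeff_card_prod_X_add_C : (∏ i ∈ s, (X + C (γ i))).coeff s.card = 1 := by
  have := (monic_prod_of_monic s (fun i => X + C (γ i)) fun i _ => monic_X_add_C (γ i)).coeff_natDegree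
  rwa [natDegree_prod_X_add_C] at this

/-- Multiplication by `X ^ 2` makes the two coefficients below the leading one available for
every `s`. -/
lemma coeff_X_sq_mul_prod_X_add_C :
    (X ^ 2 * ∏ i ∈ s, (X + C (γ i))).coeff (s.card + 1) = ∑ i ∈ s, γ i ∧
    2 * (X ^ 2 * ∏ i ∈ s, (X + C (γ i))).coeff s.card ≤ (∑ i ∈ s, γ i) ^ 2 := by
  classical
  induction s using Finset.induction_on with
  | empty => simp [coeff_X_pow]
  | insert i s hi ih =>
    rw [Finset.prod_insert hi, Finset.sum_insert hi, Finset.card_insert_of_notMem hi,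
      mul_left_comm]
    have h0 := (coeff_X_pow_mul (∏ i ∈ s, (X + C (γ i))) 2 s.card).trans coeff_card_prod_X_add_C
    set F := X ^ 2 * ∏ i ∈ s, (X + C (γ i))
    simp only [add_mul, coeff_add, coeff_X_mul, coeff_C_mul, h0]
    rw [ih.1]
    refine ⟨by ring, ?_⟩
    nlinarith [ih.2, sq_nonneg (γ i)]

lemma card_sq_le_sum_mul_sum_inv (h : ∀ i, 0 < γ i) :
    (s.card : ℝ) ^ 2 ≤ (∑ i ∈ s, γ i) * ∑ i ∈ s, (γ i)⁻¹ := by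
  rcases s.eq_empty_or_nonempty with rfl | hs
  · simp
  -- Cauchy–Schwarz in Engel form with all numerators equal to 1.
  · have h1 := Finset.sq_sum_div_le_sum_sq_div s (fun _ => (1 : ℝ)) (g := γ) fun i _ => h i
    have h2 : 0 < ∑ i ∈ s, γ i := Finset.sum_pos (fun i _ => h i) hs
    rw [div_le_iff₀ h2] at h1
    simpa [mul_comm] using h1

end

/-! ### The wall is empty -/

/-- The last three hypotheses give $u(e_1-2\rho)<\tfrac12(e_1-2\rho)(e_1+2\rho)$. If $e_1\ge 2\rho$,
then $u>e_1$ makes $\tfrac12(e_1-2\rho)^2$ negative. -/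
lemma lt_of_pattern_bounds {e₁ e₂ u v ρ : ℝ} (h₁ : e₁ < u) (h₂ : 0 < e₂ - u * e₁ + v)
    (he : 2 * e₂ ≤ e₁ ^ 2) (hv : v < 2 * ρ * u - 2 * ρ ^ 2) : e₁ < 2 * ρ := by
  by_contra! h
  nlinarith [mul_nonneg (sub_nonneg.2 h₁.le) (sub_nonneg.2 h), sq_nonneg (e₁ - 2 * ρ)]

lemma rootProd_eq_quartic {m : ℕ} (α β : ℝ) (z : ℂ) (γ : Fin m → ℝ) :
    rootProd α β z γ = (C 1 * X ^ 4 + C (-(α + β + 2 * z.re)) * X ^ 3 +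
      C (α * β + ‖z‖ ^ 2 + (α + β) * (2 * z.re)) * X ^ 2 +
      C (-((α + β) * ‖z‖ ^ 2 + α * β * (2 * z.re))) * X + C (α * β * ‖z‖ ^ 2)) *
      ∏ i, (X + C (γ i)) := by
  rw [rootProd, quad]
  simp only [map_add, map_mul, map_neg, map_one]
  ring

/-- The separating wall between the two sides is empty as soon as there are two negative roots. -/
lemma norm_sq_ne_of_hasSignPattern {k : ℕ} {α β : ℝ} {z : ℂ} {γ : Fin (k + 2) → ℝ}
    (h : Admissible α β z γ)
    (hs : HasSignPattern (rootProd α β z γ) (sigmaBullet (k + 2 + 4))) : ‖z‖ ^ 2 ≠ α * β := by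
  intro hp
  have c1 : (rootProd α β z γ).coeff 1 < 0 := by
    have := hs ⟨1, by omega⟩
    rwa [sigmaBullet, if_pos (by simp), sign_eq_neg_one_iff] at this
  have c2 : 0 < (rootProd α β z γ).coeff 2 := by
    have := hs ⟨2, by omega⟩
    rwa [sigmaBullet, if_neg (by simp), sign_eq_one_iff] at this
  have c3 : (rootProd α β z γ).coeff (k + 1 + 4) < 0 := by
    have := hs ⟨k + 1 + 4, by omega⟩
    rwa [sigmaBullet, if_pos (by simp), sign_eq_neg_one_iff] at this
  have c4 : 0 < (rootProd α β z γ).coeff (k + 4) := by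
    have := hs ⟨k + 4, by omega⟩
    rwa [sigmaBullet, if_neg (by simp), sign_eq_one_iff] at this
  rw [rootProd_eq_quartic] at c1 c2 c3 c4
  obtain ⟨-, l1, l2, -⟩ := coeff_quartic_mul_low (∏ i, (X + C (γ i))) 1 (-(α + β + 2 * z.re))
    (α * β + ‖z‖ ^ 2 + (α + β) * (2 * z.re)) (-((α + β) * ‖z‖ ^ 2 + α * β * (2 * z.re)))
    (α * β * ‖z‖ ^ 2)
  rw [l1] at c1
  rw [l2] at c2
  rw [coeff_quartic_mul] at c3 c4
  have r1 := coeff_one_prod_X_add_C (s := Finset.univ) h.neg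
  have r2 := coeff_two_prod_X_add_C_le (s := Finset.univ) (γ := γ)
  have r0 : 0 < (∏ i, (X + C (γ i))).coeff 0 :=
    coeff_prod_X_add_C_pos (s := Finset.univ) h.neg (Nat.zero_le _)
  obtain ⟨t1, t2⟩ := coeff_X_sq_mul_prod_X_add_C (s := Finset.univ) (γ := γ)
  have hd := natDegree_prod_X_add_C (s := Finset.univ) (γ := γ)
  have t0 := coeff_card_prod_X_add_C (s := Finset.univ) (γ := γ)
  have hef := card_sq_le_sum_mul_sum_inv (s := Finset.univ) h.neg
  rw [Finset.card_univ, Fintype.card_fin] at t1 t2 hd t0 hef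
  rw [show k + 2 + 1 = k + 1 + 2 from rfl, coeff_X_pow_mul] at t1
  rw [coeff_X_pow_mul] at t2
  set R := ∏ i, (X + C (γ i))
  have z3 : R.coeff (k + 3) = 0 := coeff_eq_zero_of_natDegree_lt (by omega)
  have z4 : R.coeff (k + 4) = 0 := coeff_eq_zero_of_natDegree_lt (by omega)
  have z5 : R.coeff (k + 5) = 0 := coeff_eq_zero_of_natDegree_lt (by omega)
  rw [show k + 1 + 1 = k + 2 from rfl, show k + 1 + 2 = k + 3 from rfl,
    show k + 1 + 3 = k + 4 from rfl, show k + 1 + 4 = k + 5 from rfl, t1, t0, z3, z4, z5] at c3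
  rw [t1, t0, z3, z4] at c4
  set e := ∑ i, γ i
  set f := ∑ i, (γ i)⁻¹
  set ρ := ‖z‖ with hρ
  have hρ0 : 0 < ρ := by
    rw [hρ, norm_pos_iff]
    rintro rfl
    simpa using h.im_pos
  have hre : z.re < ρ := by
    refine (Complex.re_le_norm z).lt_of_ne fun heq => ?_
    have h1 := Complex.sq_norm z
    rw [Complex.normSq_apply, heq, ← hρ] at h1
    have := mul_pos h.im_pos h.im_pos
    linarith
  -- Strict AM–GM, since `α ≠ β` and `α * β = ρ ^ 2`.
  have hsum : 2 * ρ < α + β := by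
    have h1 := h.pos
    have h2 := mul_pos (sub_pos.2 h.lt) (sub_pos.2 h.lt)
    have h3 := h.lt
    refine lt_of_pow_lt_pow_left₀ 2 (by linarith) ?_
    linarith
  rw [← hp] at c1 c2 c3 c4
  set u := α + β + 2 * z.re with hu
  -- The difference of the two sides is $2(\alpha+\beta-2\rho)(\rho-\operatorname{Re}z)$.
  have hv : ρ ^ 2 + ρ ^ 2 + (α + β) * (2 * z.re) < 2 * ρ * u - 2 * ρ ^ 2 := by
    have := mul_pos (sub_pos.2 hsum) (sub_pos.2 hre)
    rw [hu]
    linarith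
  set v := ρ ^ 2 + ρ ^ 2 + (α + β) * (2 * z.re)
  have hw : (α + β) * ρ ^ 2 + ρ ^ 2 * (2 * z.re) = ρ ^ 2 * u := by rw [hu]; ring
  rw [hw] at c1 c2 c3 c4
  have he : e < 2 * ρ := by
    refine lt_of_pattern_bounds (e₂ := R.coeff k) (u := u) (v := v) ?_ ?_ t2 hv <;> linarith
  -- The same bound for the polynomial reversed by $x\mapsto\rho^2/x$: each `γ i` becomes `ρ ^ 2 / γ
  -- i`, while `u`, `v` and `ρ` are unchanged.
  have hf : ρ ^ 2 * f < 2 * ρ := by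
    have hρ2 : 0 < ρ ^ 2 := by positivity
    refine lt_of_pattern_bounds (e₂ := ρ ^ 4 * (R.coeff 2 / R.coeff 0)) (u := u) (v := v)
      ?_ ?_ ?_ hv
    · rw [r1] at c1
      refine lt_of_mul_lt_mul_left (a := ρ ^ 2 * R.coeff 0) ?_ (by positivity)
      linarith
    · rw [r1] at c2
      refine pos_of_mul_pos_right (a := R.coeff 0) ?_ r0.le
      field_simp
      linarith
    · rw [r1] at r2
      have : 2 * (R.coeff 2 / R.coeff 0) ≤ f ^ 2 := by
        rw [mul_div_assoc', div_le_iff₀ r0]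
        refine le_of_mul_le_mul_right ?_ r0
        linarith
      have := mul_le_mul_of_nonneg_left this (show 0 ≤ ρ ^ 4 by positivity)
      linarith
  have hf0 : 0 ≤ f := Finset.sum_nonneg fun i _ => (inv_pos.2 (h.neg i)).le
  have he0 : 0 ≤ e := Finset.sum_nonneg fun i _ => (h.neg i).le
  -- The only place where at least two negative roots are needed.
  have h4 : (4 : ℝ) ≤ e * f := by
    refine le_trans ?_ hef
    push_cast
    nlinarith [Nat.cast_nonneg (α := ℝ) k]
  have h5 : e * (ρ ^ 2 * f) < 2 * ρ * (2 * ρ) :=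
    mul_lt_mul'' he hf he0 (by positivity)
  nlinarith [mul_le_mul_of_nonneg_left h4 (sq_nonneg ρ)]

/-! ### Each side is a union of components -/

lemma closure_sideSet_inter_R3_subset {k : ℕ} {c : ℝ} (hc : c ≠ 0) :
    closure (sideSet (m := k + 2) (sigmaBullet (k + 2 + 4)) c) ∩ R3 (k + 2 + 4) ⊆
      sideSet (m := k + 2) (sigmaBullet (k + 2 + 4)) c := by
  rintro a ⟨ha, ha3⟩
  have hs := hasSignPattern_of_mem_closure (closure_mono (fun b hb => hb.1) ha) ha3.2
  obtain ⟨p, hp, hP⟩ := exists_params_of_mem_closure ha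
  obtain ⟨hadm, hside⟩ := admissible_of_mem_closure ha3 hp hP
  refine ⟨hs, p, ⟨hadm, hside.lt_of_ne' (mul_ne_zero hc (sub_ne_zero.2 ?_))⟩, hP⟩
  exact norm_sq_ne_of_hasSignPattern hadm (hP ▸ hs)

lemma A_eq_union_sideSet {k : ℕ} :
    A (sigmaBullet (k + 2 + 4)) 2 (k + 2) =
      sideSet (m := k + 2) (sigmaBullet (k + 2 + 4)) 1 ∪
        sideSet (m := k + 2) (sigmaBullet (k + 2 + 4)) (-1) := by
  refine Set.Subset.antisymm ?_ (Set.union_subset sideSet_subset_A sideSet_subset_A)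
  intro a ha
  obtain ⟨hs, α, β, z, γ, h, hP⟩ := mem_A_iff.1 ha
  rcases (norm_sq_ne_of_hasSignPattern h (hP ▸ hs)).lt_or_gt with hlt | hlt
  · exact Or.inr ⟨hs, (α, β, z, γ), ⟨h, by simpa using hlt⟩, hP⟩
  · exact Or.inl ⟨hs, (α, β, z, γ), ⟨h, by simpa using hlt⟩, hP⟩

/-- The polynomial determines `α`, `β` and `z`, thanks to `α < β` and `0 < z.im`, and hence the sign
of `‖z‖ ^ 2 - α * β`. -/
lemma disjoint_sideSet {m : ℕ} {σ : Fin (m + 4 + 1) → SignType} :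
    Disjoint (sideSet σ 1) (sideSet σ (-1)) := by
  rw [Set.disjoint_left]
  rintro a ⟨-, ⟨α, β, z, γ⟩, hp, hP⟩ ⟨-, ⟨α', β', z', γ'⟩, hq, hQ⟩
  have h1 := hp.1
  have h2 := hq.1
  simp only at h1 h2 hP hQ
  rw [hP] at hQ
  have hset : ∀ x : ℝ, 0 < x → (x = α ∨ x = β ↔ x = α' ∨ x = β') := fun x hx => by
    have e1 : x = α ∨ x = β ↔ (rootProd α β z γ).IsRoot x := by
      rw [h1.isRoot_iff, ← or_assoc]
      refine (or_iff_left ?_).symm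
      rintro ⟨i, rfl⟩
      linarith [h1.neg i]
    have e2 : x = α' ∨ x = β' ↔ (rootProd α' β' z' γ').IsRoot x := by
      rw [h2.isRoot_iff, ← or_assoc]
      refine (or_iff_left ?_).symm
      rintro ⟨i, rfl⟩
      linarith [h2.neg i]
    rw [e1, e2, hQ]
  have hz : z = z' := by
    have h3 := h1.aeval_eq_zero_iff.2 (Or.inl (rfl : z = z))
    rw [hQ] at h3
    rcases h2.aeval_eq_zero_iff.1 h3 with h | h
    · exact h
    · have h4 := h1.im_pos
      have h5 := h2.im_pos
      rw [h, Complex.conj_im] at h4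
      linarith
  have p1 := h1.pos
  have p2 := h2.pos
  have l1 := h1.lt
  have l2 := h2.lt
  have m1 := (hset α p1).1 (Or.inl rfl)
  have m2 := (hset β (p1.trans l1)).1 (Or.inr rfl)
  have m3 := (hset α' p2).2 (Or.inl rfl)
  have hα : α = α' := by
    rcases m1 with h | h
    · exact h
    · rcases m2 with h' | h' <;> linarith
  have hβ : β = β' := by
    rcases m2 with h | h
    · linarith
    · exact h
  have q1 := hp.2
  have q2 := hq.2
  simp only at q1 q2
  rw [hα, hβ, hz] at q1
  linarith

/-- The side is relatively clopen in `R3`, so a connected subset of `R3` meeting it cannot leave it.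
-/
lemma connectedComponentIn_subset_sideSet {k : ℕ} {c : ℝ} (hc : c ≠ 0) {a : Fin (k + 2 + 4) → ℝ}
    (ha : a ∈ sideSet (m := k + 2) (sigmaBullet (k + 2 + 4)) c) :
    connectedComponentIn (R3 (k + 2 + 4)) a ⊆
      sideSet (m := k + 2) (sigmaBullet (k + 2 + 4)) c := by
  have ha3 : a ∈ R3 (k + 2 + 4) := A_subset_R3 sigmaBullet_ne_zero (sideSet_subset_A ha)
  refine isPreconnected_connectedComponentIn.subset_of_closure_inter_subset
    (isOpen_sideSet sigmaBullet_ne_zero c) ⟨a, mem_connectedComponentIn ha3, ha⟩ ?_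
  exact (Set.inter_subset_inter_right _ (connectedComponentIn_subset _ _)).trans
    (closure_sideSet_inter_R3_subset hc)

theorem A_eq_sUnion_components {k : ℕ}
    (h₁ : (sideSet (m := k + 2) (sigmaBullet (k + 2 + 4)) 1).Nonempty)
    (h₂ : (sideSet (m := k + 2) (sigmaBullet (k + 2 + 4)) (-1)).Nonempty) :
    (∃ K : Set (Set (Fin (k + 2 + 4) → ℝ)), K ⊆ componentsOf (R3 (k + 2 + 4)) ∧
      K.Nontrivial ∧ A (sigmaBullet (k + 2 + 4)) 2 (k + 2) = ⋃₀ K) ∧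
    ¬ IsConnected (A (sigmaBullet (k + 2 + 4)) 2 (k + 2)) := by
  obtain ⟨a, ha⟩ := h₁
  obtain ⟨b, hb⟩ := h₂
  have hA := A_subset_R3 (d := k + 2 + 4) (pos := 2) (neg := k + 2) sigmaBullet_ne_zero
  have ha3 := hA (sideSet_subset_A ha)
  have hb3 := hA (sideSet_subset_A hb)
  have hsub : b ∉ connectedComponentIn (R3 (k + 2 + 4)) a := fun h =>
    Set.disjoint_left.1 disjoint_sideSet
      (connectedComponentIn_subset_sideSet one_ne_zero ha h) hb
  refine ⟨⟨(fun x => connectedComponentIn (R3 (k + 2 + 4)) x) ''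
    A (sigmaBullet (k + 2 + 4)) 2 (k + 2), ?_, ?_, ?_⟩, ?_⟩
  · rintro _ ⟨x, hx, rfl⟩
    exact ⟨x, hA hx, rfl⟩
  · refine ⟨_, ⟨a, sideSet_subset_A ha, rfl⟩, _, ⟨b, sideSet_subset_A hb, rfl⟩, fun h => hsub ?_⟩
    have := mem_connectedComponentIn hb3
    exact h.ge this
  · refine Set.Subset.antisymm (fun x hx => ⟨_, ⟨x, hx, rfl⟩, mem_connectedComponentIn (hA hx)⟩) ?_
    rintro y ⟨_, ⟨x, hx, rfl⟩, hy⟩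
    rw [A_eq_union_sideSet] at hx
    rcases hx with hx | hx
    · exact sideSet_subset_A (connectedComponentIn_subset_sideSet one_ne_zero hx hy)
    · exact sideSet_subset_A (connectedComponentIn_subset_sideSet (by norm_num) hx hy)
  · intro hconn
    exact hsub (hconn.isPreconnected.subset_connectedComponentIn (sideSet_subset_A ha) hA
      (sideSet_subset_A hb))

/-! ### Polynomials on both sides of the wall -/

/-- `R` times a quadratic with small roots and a quadratic with large roots, rescaled. -/
def scaledProd (κ κ' δ : ℝ) (R : ℝ[X]) : ℝ[X] :=
  (X ^ 2 - C δ * X + C (κ * δ ^ 2)) * (C (κ' * δ ^ 2) * X ^ 2 - C δ * X + 1) * R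

lemma scaledProd_eq (κ κ' δ : ℝ) (R : ℝ[X]) : scaledProd κ κ' δ R =
    (C (κ' * δ ^ 2) * X ^ 4 + C (-(δ * (1 + κ' * δ ^ 2))) * X ^ 3 +
      C (1 + δ ^ 2 + κ * κ' * δ ^ 4) * X ^ 2 + C (-(δ * (1 + κ * δ ^ 2))) * X +
      C (κ * δ ^ 2)) * R := by
  rw [scaledProd]
  simp only [map_add, map_mul, map_neg, map_one, map_pow]
  ring

lemma eventually_pos_of_continuous {f : ℝ → ℝ} (hf : Continuous f) (h0 : 0 < f 0) :
    ∀ᶠ δ in 𝓝[>] (0 : ℝ), 0 < f δ :=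
  (hf.continuousAt.eventually (lt_mem_nhds h0)).filter_mono nhdsWithin_le_nhds

/-- As `δ` tends to 0 the quartic factor tends to $x^2$, so the middle coefficients tend to those of
`R`. The coefficients next to the two ends are dominated by $-\delta$ times an end coefficient of
`R`, and the two extreme ones are positive multiples of $\delta^2$. -/
lemma eventually_hasSignPattern_scaledProd {m : ℕ} {κ κ' : ℝ} (hκ : 0 < κ) (hκ' : 0 < κ')
    {R : ℝ[X]} (hR : ∀ j ≤ m, 0 < R.coeff j) (hd : R.natDegree = m) :
    ∀ᶠ δ in 𝓝[>] (0 : ℝ), HasSignPattern (scaledProd κ κ' δ R) (sigmaBullet (m + 4)) := by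
  refine eventually_all.2 fun j => ?_
  obtain ⟨j, hj⟩ := j
  have hz : ∀ n, m < n → R.coeff n = 0 := fun n hn => coeff_eq_zero_of_natDegree_lt (hd ▸ hn)
  have hpos : ∀ᶠ δ in 𝓝[>] (0 : ℝ), 0 < δ := self_mem_nhdsWithin
  simp only [scaledProd_eq]
  have hlow := fun δ : ℝ => coeff_quartic_mul_low R (κ' * δ ^ 2) (-(δ * (1 + κ' * δ ^ 2)))
    (1 + δ ^ 2 + κ * κ' * δ ^ 4) (-(δ * (1 + κ * δ ^ 2))) (κ * δ ^ 2)
  have hmid : ∀ i ≤ m, ∀ a b c d : ℝ, ∀ᶠ δ in 𝓝[>] (0 : ℝ),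
      0 < κ' * δ ^ 2 * a + -(δ * (1 + κ' * δ ^ 2)) * b + (1 + δ ^ 2 + κ * κ' * δ ^ 4) * R.coeff i +
        -(δ * (1 + κ * δ ^ 2)) * c + κ * δ ^ 2 * d := fun i hi a b c d =>
    eventually_pos_of_continuous (by fun_prop) (by simpa using hR i hi)
  have hlin : ∀ i ≤ m, ∀ a κ₁ κ₂ : ℝ, ∀ᶠ δ in 𝓝[>] (0 : ℝ),
      -(δ * (1 + κ₁ * δ ^ 2)) * R.coeff i + κ₂ * δ ^ 2 * a < 0 := fun i hi a κ₁ κ₂ => by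
    have := eventually_pos_of_continuous
      (f := fun δ => (1 + κ₁ * δ ^ 2) * R.coeff i - κ₂ * δ * a) (by fun_prop)
      (by simpa using hR i hi)
    filter_upwards [this, hpos] with δ h1 h2
    have := mul_pos h2 h1
    linarith
  match j, hj with
  | 0, _ =>
    filter_upwards [hpos] with δ hδ
    have h0 := hR 0 (Nat.zero_le _)
    rw [sigmaBullet, if_neg (by simp), sign_eq_one_iff]
    simp only [(hlow δ).1]
    positivity
  | 1, _ =>
    filter_upwards [hlin 0 (Nat.zero_le _) (R.coeff 1) κ κ] with δ hδ
    rw [sigmaBullet, if_pos (by simp), sign_eq_neg_one_iff]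
    simp only [(hlow δ).2.1]
    exact hδ
  | 2, _ =>
    filter_upwards [hmid 0 (Nat.zero_le _) 0 0 (R.coeff 1) (R.coeff 2)] with δ hδ
    rw [sigmaBullet, if_neg (by simp), sign_eq_one_iff]
    simp only [(hlow δ).2.2.1]
    linarith
  | 3, hj =>
    obtain _ | m := m
    · filter_upwards [hlin 0 le_rfl 0 κ' 0] with δ hδ
      rw [sigmaBullet, if_pos (by simp), sign_eq_neg_one_iff]
      simp only [(hlow δ).2.2.2]
      rw [hz 1 (by omega), hz 2 (by omega), hz 3 (by omega)]
      linarith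
    · filter_upwards [hmid 1 (by omega) 0 (R.coeff 0) (R.coeff 2) (R.coeff 3)] with δ hδ
      rw [sigmaBullet, if_neg (by simp), sign_eq_one_iff]
      simp only [(hlow δ).2.2.2]
      linarith
  | i + 4, hj =>
    simp only [coeff_quartic_mul]
    rcases (show i + 2 ≤ m ∨ i + 1 = m ∨ i = m by omega) with h | h | h
    · filter_upwards [hmid (i + 2) h (R.coeff i) (R.coeff (i + 1)) (R.coeff (i + 3))
        (R.coeff (i + 4))] with δ hδ
      rw [sigmaBullet, if_neg (by simp; omega), sign_eq_one_iff]
      exact hδ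
    · filter_upwards [hlin (i + 1) h.le (R.coeff i) κ' κ'] with δ hδ
      rw [sigmaBullet, if_pos (by simp; omega), sign_eq_neg_one_iff, hz (i + 2) (by omega),
        hz (i + 3) (by omega), hz (i + 4) (by omega)]
      linarith
    · filter_upwards [hpos] with δ hδ
      have h0 := hR i h.le
      rw [sigmaBullet, if_neg (by simp; omega), sign_eq_one_iff, hz (i + 1) (by omega),
        hz (i + 2) (by omega), hz (i + 3) (by omega), hz (i + 4) (by omega)]
      simp only [mul_zero, add_zero]
      positivity

lemma HasSignPattern.of_C_mul {d : ℕ} {P : ℝ[X]} {σ : Fin (d + 1) → SignType} {c : ℝ} (hc : 0 < c)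
    (h : HasSignPattern (C c * P) σ) : HasSignPattern P σ := fun j => by
  have := h j
  rwa [coeff_C_mul, sign_mul, sign_pos hc, one_mul] at this

lemma sideSet_nonempty_of_rootProd {m : ℕ} {σ : Fin (m + 4 + 1) → SignType} {c : ℝ} {p : Params m}
    (hp : p ∈ sideParams m c)
    (h : HasSignPattern (rootProd p.1 p.2.1 p.2.2.1 p.2.2.2) σ) : (sideSet σ c).Nonempty := by
  have := eq_monicPoly (monic_rootProd (α := p.1) (β := p.2.1) (z := p.2.2.1) (γ := p.2.2.2))
    natDegree_rootProd
  exact ⟨_, this ▸ h, p, hp, this.symm⟩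

lemma sideSet_sigmaBullet_nonempty (m : ℕ) :
    (sideSet (m := m) (sigmaBullet (m + 4)) 1).Nonempty ∧
      (sideSet (m := m) (sigmaBullet (m + 4)) (-1)).Nonempty := by
  let γ : Fin m → ℝ := fun i => (i : ℕ) + 1
  have hγ : ∀ i, 0 < γ i := fun i => by positivity
  have hinj : Function.Injective γ := fun i j hij => by
    have : ((i : ℕ) : ℝ) = (j : ℕ) := add_right_cancel hij
    exact Fin.ext (Nat.cast_injective this)
  have hR : ∀ j ≤ m, 0 < (∏ i, (X + C (γ i))).coeff j := fun j hj =>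
    coeff_prod_X_add_C_pos (s := Finset.univ) hγ (by simpa using hj)
  have hd : (∏ i, (X + C (γ i))).natDegree = m :=
    natDegree_prod_X_add_C.trans (by simp)
  have hpos : ∀ᶠ δ in 𝓝[>] (0 : ℝ), 0 < δ := self_mem_nhdsWithin
  have hlt : ∀ᶠ δ in 𝓝[>] (0 : ℝ), δ < 1 :=
    (gt_mem_nhds one_pos).filter_mono nhdsWithin_le_nhds
  -- The quadratics have discriminants $\delta^2(1-4\kappa)$ and $\delta^2(1-4\kappa')$: the value
  -- 2/9 gives real roots with rational coefficients in `δ` or `δ⁻¹`, the value 1/2 a non-real pair.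
  -- Swapping the two values swaps which pair is small.
  obtain ⟨δ, h₁, h₂, hδ, hδ1⟩ := ((eventually_hasSignPattern_scaledProd (κ := 2 / 9) (κ' := 1 / 2)
    (by norm_num) (by norm_num) hR hd).and ((eventually_hasSignPattern_scaledProd (κ := 1 / 2)
    (κ' := 2 / 9) (by norm_num) (by norm_num) hR hd).and (hpos.and hlt))).exists
  have hδ0 := hδ.ne'
  have hδ2 : δ ^ 2 < 1 := by nlinarith
  have hδi : 1 < (δ ^ 2)⁻¹ := (one_lt_inv₀ (by positivity)).2 hδ2
  have hC : (C δ * C δ⁻¹ : ℝ[X]) = 1 := by rw [← C_mul, mul_inv_cancel₀ hδ0, C_1]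
  constructor
  · refine sideSet_nonempty_of_rootProd (p := (1 / 3 * δ, 2 / 3 * δ, ⟨δ⁻¹, δ⁻¹⟩, γ))
      ⟨⟨?_, ?_, ?_, hγ, hinj⟩, ?_⟩ ?_
    · positivity
    · simp only; linarith
    · simpa using hδ
    · simp only [Complex.sq_norm, Complex.normSq_mk]
      have : δ⁻¹ * δ⁻¹ = (δ ^ 2)⁻¹ := by field_simp
      rw [this]
      linarith
    · refine HasSignPattern.of_C_mul (c := 1 / 2 * δ ^ 2) (by positivity) ?_
      convert h₁ using 1
      refine Polynomial.funext fun x => ?_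
      simp only [scaledProd, eval_mul, eval_rootProd, eval_add, eval_sub, eval_pow, eval_X, eval_C,
        eval_one, eval_prod]
      field_simp
      ring
  · refine sideSet_nonempty_of_rootProd (p := (3 / 2 * δ⁻¹, 3 * δ⁻¹, ⟨δ / 2, δ / 2⟩, γ))
      ⟨⟨?_, ?_, ?_, hγ, hinj⟩, ?_⟩ ?_
    · positivity
    · have := inv_pos.2 hδ
      simp only; linarith
    · simpa using hδ
    · simp only [Complex.sq_norm, Complex.normSq_mk]
      have : 3 / 2 * δ⁻¹ * (3 * δ⁻¹) = 9 / 2 * (δ ^ 2)⁻¹ := by field_simp; norm_num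
      rw [this]
      linarith
    · refine HasSignPattern.of_C_mul (c := 2 / 9 * δ ^ 2) (by positivity) ?_
      convert h₂ using 1
      refine Polynomial.funext fun x => ?_
      simp only [scaledProd, eval_mul, eval_rootProd, eval_add, eval_sub, eval_pow, eval_X, eval_C,
        eval_one, eval_prod]
      field_simp
      ring

/-! ### Connectedness through convex fibres -/

/-- Two open pieces covering `T` have open projections covering `B`, which overlap because `B` is
preconnected. A fibre over the overlap meets both pieces, and so meets their intersection. -/
lemma isPreconnected_of_fibers {E F : Type*} [TopologicalSpace E] [TopologicalSpace F]
    {T : Set (E × F)} (hT : IsOpen T) {B : Set E} (hB : IsPreconnected B)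
    (hBT : Prod.fst '' T = B) (hfib : ∀ x, IsPreconnected {y | (x, y) ∈ T}) :
    IsPreconnected T := by
  intro U V hU hV hcov hTU hTV
  have hcov' : B ⊆ Prod.fst '' (T ∩ U) ∪ Prod.fst '' (T ∩ V) := by
    rw [← Set.image_union, ← Set.inter_union_distrib_left, Set.inter_eq_left.2 hcov, hBT]
  have hne : ∀ W : Set (E × F), (T ∩ W).Nonempty → (B ∩ Prod.fst '' (T ∩ W)).Nonempty := by
    rintro W ⟨p, hp⟩
    exact ⟨p.1, hBT ▸ ⟨p, hp.1, rfl⟩, p, hp, rfl⟩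
  obtain ⟨_, -, ⟨⟨x, y₁⟩, ⟨h₁, hu⟩, rfl⟩, ⟨⟨x', y₂⟩, ⟨h₂, hv⟩, hx⟩⟩ :=
    hB _ _ (isOpenMap_fst _ (hT.inter hU)) (isOpenMap_fst _ (hT.inter hV)) hcov' (hne U hTU)
      (hne V hTV)
  obtain rfl : x' = x := hx
  obtain ⟨y, hy, hyu, hyv⟩ := hfib x' {y | (x', y) ∈ U} {y | (x', y) ∈ V}
    (hU.preimage (by fun_prop)) (hV.preimage (by fun_prop)) (fun y hy => hcov hy) ⟨y₁, h₁, hu⟩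
    ⟨y₂, h₂, hv⟩
  exact ⟨(x', y), hy, hyu, hyv⟩

lemma convex_halfPlane (c₀ c₁ c₂ : ℝ) : Convex ℝ {y : ℝ × ℝ | 0 < c₀ + c₁ * y.1 + c₂ * y.2} := by
  intro y hy w hw a b ha hb hab
  simp only [Set.mem_ofPred_eq, Prod.fst_add, Prod.snd_add, Prod.smul_fst, Prod.smul_snd,
    smul_eq_mul] at *
  have key : c₀ + c₁ * (a * y.1 + b * w.1) + c₂ * (a * y.2 + b * w.2) =
      a * (c₀ + c₁ * y.1 + c₂ * y.2) + b * (c₀ + c₁ * w.1 + c₂ * w.2) := by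
    linear_combination (-c₀) * hab
  rw [key]
  rcases ha.eq_or_lt with rfl | ha
  · obtain rfl : b = 1 := by linarith
    simpa using hw
  · exact add_pos_of_pos_of_nonneg (mul_pos ha hy) (mul_nonneg hb hw.le)

lemma convex_setOf_pos_lt : Convex ℝ {x : ℝ × ℝ | 0 < x.1 ∧ x.1 < x.2} := by
  have h : {x : ℝ × ℝ | 0 < x.1 ∧ x.1 < x.2} =
      {y | 0 < 0 + 1 * y.1 + 0 * y.2} ∩ {y | 0 < 0 + (-1) * y.1 + 1 * y.2} := by
    ext x
    simp [← sub_eq_neg_add]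
  rw [h]
  exact (convex_halfPlane 0 1 0).inter (convex_halfPlane 0 (-1) 1)

lemma convex_parabola : Convex ℝ {y : ℝ × ℝ | y.1 ^ 2 < 4 * y.2} := by
  intro y hy w hw a b ha hb hab
  simp only [Set.mem_ofPred_eq, Prod.fst_add, Prod.snd_add, Prod.smul_fst, Prod.smul_snd,
    smul_eq_mul] at *
  obtain rfl : b = 1 - a := by linarith
  -- The convexity defect of the square is $a(1-a)$ times the squared difference.
  have key : (a * y.1 + (1 - a) * w.1) ^ 2 =
      a * y.1 ^ 2 + (1 - a) * w.1 ^ 2 - a * (1 - a) * (y.1 - w.1) ^ 2 := by ring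
  rw [key]
  have h1 : 0 ≤ a * (1 - a) * (y.1 - w.1) ^ 2 := by positivity
  rcases ha.eq_or_lt with rfl | ha
  · linarith
  · have := mul_lt_mul_of_pos_left hy ha
    have := mul_le_mul_of_nonneg_left hw.le hb
    linarith

lemma exists_complex_of_sq_lt {t q : ℝ} (h : t ^ 2 < 4 * q) :
    ∃ z : ℂ, 0 < z.im ∧ 2 * z.re = t ∧ ‖z‖ ^ 2 = q := by
  have h0 : 0 < q - t ^ 2 / 4 := by linarith
  refine ⟨⟨t / 2, √(q - t ^ 2 / 4)⟩, Real.sqrt_pos.2 h0, by ring, ?_⟩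
  rw [Complex.sq_norm, Complex.normSq_mk, Real.mul_self_sqrt h0.le]
  ring

lemma mem_A_iff_quadratic {m : ℕ} {σ : Fin (m + 4 + 1) → SignType} {a : Fin (m + 4) → ℝ} :
    a ∈ A σ 2 m ↔ HasSignPattern (monicPoly a) σ ∧ ∃ α β t q : ℝ, ∃ γ : Fin m → ℝ,
      0 < α ∧ α < β ∧ t ^ 2 < 4 * q ∧ (∀ i, 0 < γ i) ∧ Function.Injective γ ∧
      monicPoly a =
        (X - C α) * (X - C β) * (X ^ 2 - C t * X + C q) * ∏ i, (X + C (γ i)) := by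
  rw [mem_A_iff]
  refine and_congr_right fun _ => ⟨?_, ?_⟩
  · rintro ⟨α, β, z, γ, h, hP⟩
    refine ⟨α, β, 2 * z.re, ‖z‖ ^ 2, γ, h.pos, h.lt, ?_, h.neg, h.inj, hP⟩
    have := mul_pos h.im_pos h.im_pos
    rw [Complex.sq_norm, Complex.normSq_apply]
    linarith
  · rintro ⟨α, β, t, q, γ, h1, h2, h3, h4, h5, hP⟩
    obtain ⟨z, hz, rfl, rfl⟩ := exists_complex_of_sq_lt h3
    exact ⟨α, β, z, γ, ⟨h1, h2, hz, h4, h5⟩, hP⟩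

lemma hasSignPattern_monicPoly_iff {d : ℕ} {a : Fin d → ℝ} {σ : Fin (d + 1) → SignType}
    (hσ : σ (Fin.last d) = 1) :
    HasSignPattern (monicPoly a) σ ↔ ∀ j, SignType.sign (a j) = σ j.castSucc := by
  constructor
  · intro h j
    rw [← h, Fin.val_castSucc, coeff_monicPoly_lt]
  · intro h j
    refine Fin.lastCases ?_ (fun i => ?_) j
    · rw [Fin.val_last, coeff_monicPoly_self, hσ, sign_one]
    · rw [Fin.val_castSucc, coeff_monicPoly_lt, h]

/-! ### Degree 4 -/

section Quartic

/-- The coefficients of `(x - α) (x - β) (x ^ 2 - t x + q)`. -/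
def quarticCoeffs (p : (ℝ × ℝ) × ℝ × ℝ) : Fin 4 → ℝ :=
  ![p.1.1 * p.1.2 * p.2.2, -((p.1.1 + p.1.2) * p.2.2 + p.2.1 * (p.1.1 * p.1.2)),
    p.1.1 * p.1.2 + p.2.2 + (p.1.1 + p.1.2) * p.2.1, -(p.1.1 + p.1.2 + p.2.1)]

/-- The parameters for which `quarticCoeffs` has the sign pattern `sigmaBullet 4`. -/
def quarticParams : Set ((ℝ × ℝ) × ℝ × ℝ) :=
  {p | (0 < p.1.1 ∧ p.1.1 < p.1.2) ∧ p.2.1 ^ 2 < 4 * p.2.2 ∧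
    0 < (p.1.1 + p.1.2) * p.2.2 + p.2.1 * (p.1.1 * p.1.2) ∧
    0 < p.1.1 * p.1.2 + p.2.2 + (p.1.1 + p.1.2) * p.2.1 ∧ 0 < p.1.1 + p.1.2 + p.2.1}

lemma monicPoly_quarticCoeffs (α β t q : ℝ) : monicPoly (quarticCoeffs ((α, β), t, q)) =
    (X - C α) * (X - C β) * (X ^ 2 - C t * X + C q) := by
  simp only [monicPoly, quarticCoeffs, Fin.sum_univ_four, Matrix.cons_val, Fin.coe_ofNat_eq_mod,
    map_add, map_mul, map_neg]
  norm_num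
  ring

lemma hasSignPattern_quarticCoeffs {α β t q : ℝ} (hα : 0 < α) (hβ : α < β) (hq : t ^ 2 < 4 * q) :
    HasSignPattern (monicPoly (quarticCoeffs ((α, β), t, q))) (sigmaBullet 4) ↔
      ((α, β), t, q) ∈ quarticParams := by
  have h0 : 0 < q := by nlinarith [sq_nonneg t]
  have h1 : 0 < α * β * q := mul_pos (mul_pos hα (hα.trans hβ)) h0
  rw [hasSignPattern_monicPoly_iff (by simp [sigmaBullet])]
  simp only [quarticParams, quarticCoeffs, sigmaBullet, Fin.forall_fin_succ, Set.mem_ofPred_eq]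
  simp [hα, hβ, hq, sign_pos h1, sign_eq_one_iff, sign_eq_neg_one_iff, -neg_add_rev]

lemma A_four_eq : A (sigmaBullet 4) 2 0 = quarticCoeffs '' quarticParams := by
  ext a
  refine (mem_A_iff_quadratic (m := 0)).trans ⟨?_, ?_⟩
  · rintro ⟨hs, α, β, t, q, γ, h1, h2, h3, -, -, hP⟩
    rw [Finset.univ_eq_empty, Finset.prod_empty, mul_one, ← monicPoly_quarticCoeffs] at hP
    have ha := monicPoly_injective hP
    rw [ha] at hs
    exact ⟨_, (hasSignPattern_quarticCoeffs h1 h2 h3).1 hs, ha.symm⟩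
  · rintro ⟨⟨⟨α, β⟩, t, q⟩, hp, rfl⟩
    refine ⟨(hasSignPattern_quarticCoeffs hp.1.1 hp.1.2 hp.2.1).2 hp, α, β, t, q, Fin.elim0,
      hp.1.1, hp.1.2, hp.2.1, fun i => i.elim0, fun i => i.elim0, ?_⟩
    rw [Finset.univ_eq_empty, Finset.prod_empty, mul_one, ← monicPoly_quarticCoeffs]

lemma isPreconnected_quarticParams : IsPreconnected quarticParams := by
  refine isPreconnected_of_fibers ?_ (B := {x | 0 < x.1 ∧ x.1 < x.2}) ?_ ?_ fun x => ?_
  · unfold quarticParams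
    refine ((?_ : IsOpen _).and ?_).and <| IsOpen.and ?_ <| IsOpen.and ?_ <| IsOpen.and ?_ ?_
    all_goals exact isOpen_lt (by fun_prop) (by fun_prop)
  · exact convex_setOf_pos_lt.isPreconnected
  · ext x
    constructor
    · rintro ⟨p, hp, rfl⟩
      exact hp.1
    · intro hx
      have h1 := hx.1
      have h2 := hx.1.trans hx.2
      -- The cofactor $x^2+1$ works over every pair of positive roots.
      refine ⟨(x, 0, 1), ⟨hx, ?_⟩, rfl⟩
      norm_num
      refine ⟨?_, ?_, ?_⟩ <;> positivity
  · by_cases hx : 0 < x.1 ∧ x.1 < x.2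
    · have h : {y | (x, y) ∈ quarticParams} = {y | y.1 ^ 2 < 4 * y.2} ∩
          ({y | 0 < 0 + x.1 * x.2 * y.1 + (x.1 + x.2) * y.2} ∩
          ({y | 0 < x.1 * x.2 + (x.1 + x.2) * y.1 + 1 * y.2} ∩
          {y | 0 < x.1 + x.2 + 1 * y.1 + 0 * y.2})) := by
        ext y
        simp only [quarticParams, hx, Set.mem_ofPred_eq, Set.mem_inter_iff, true_and, and_self]
        ring_nf
      rw [h]
      exact (convex_parabola.inter <| (convex_halfPlane _ _ _).inter <|
        (convex_halfPlane _ _ _).inter (convex_halfPlane _ _ _)).isPreconnected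
    · convert isPreconnected_empty
      ext y
      simp only [quarticParams, hx, Set.mem_ofPred_eq, false_and, Set.mem_empty_iff_false]

theorem isConnected_A_four : IsConnected (A (sigmaBullet 4) 2 0) := by
  rw [A_four_eq]
  refine ⟨⟨_, ((1, 2), 0, 1), by norm_num [quarticParams], rfl⟩,
    isPreconnected_quarticParams.image _ (Continuous.continuousOn ?_)⟩
  refine continuous_pi fun j => ?_
  fin_cases j <;> simp only [quarticCoeffs] <;> simp <;> fun_prop

end Quartic

/-! ### Degree 5 -/

section Quintic

/-- The coefficients of `(x - α) (x - β) (x ^ 2 - t x + q) (x + g)`. -/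
def quinticCoeffs (p : (ℝ × ℝ × ℝ) × ℝ × ℝ) : Fin 5 → ℝ :=
  let s := p.1.1 + p.1.2.1
  let r := p.1.1 * p.1.2.1
  let g := p.1.2.2
  let t := p.2.1
  let q := p.2.2
  ![r * q * g, -((s * q + t * r) * g - r * q), (r + q + s * t) * g - (s * q + t * r),
    r + q + s * t - (s + t) * g, -(s + t - g)]

/-- The parameters for which `quinticCoeffs` has the sign pattern `sigmaBullet 5`. -/
def quinticParams : Set ((ℝ × ℝ × ℝ) × ℝ × ℝ) :=
  {p | (0 < p.1.1 ∧ p.1.1 < p.1.2.1 ∧ 0 < p.1.2.2) ∧ p.2.1 ^ 2 < 4 * p.2.2 ∧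
    0 < ((p.1.1 + p.1.2.1) * p.2.2 + p.2.1 * (p.1.1 * p.1.2.1)) * p.1.2.2 -
      p.1.1 * p.1.2.1 * p.2.2 ∧
    0 < (p.1.1 * p.1.2.1 + p.2.2 + (p.1.1 + p.1.2.1) * p.2.1) * p.1.2.2 -
      ((p.1.1 + p.1.2.1) * p.2.2 + p.2.1 * (p.1.1 * p.1.2.1)) ∧
    0 < p.1.1 * p.1.2.1 + p.2.2 + (p.1.1 + p.1.2.1) * p.2.1 -
      (p.1.1 + p.1.2.1 + p.2.1) * p.1.2.2 ∧
    0 < p.1.1 + p.1.2.1 + p.2.1 - p.1.2.2}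

lemma monicPoly_quinticCoeffs (α β g t q : ℝ) : monicPoly (quinticCoeffs ((α, β, g), t, q)) =
    (X - C α) * (X - C β) * (X ^ 2 - C t * X + C q) * (X + C g) := by
  simp only [monicPoly, quinticCoeffs, Fin.sum_univ_five, Matrix.cons_val, Fin.coe_ofNat_eq_mod,
    map_add, map_sub, map_mul, map_neg]
  norm_num
  ring

lemma hasSignPattern_quinticCoeffs {α β g t q : ℝ} (hα : 0 < α) (hβ : α < β) (hg : 0 < g)
    (hq : t ^ 2 < 4 * q) :
    HasSignPattern (monicPoly (quinticCoeffs ((α, β, g), t, q))) (sigmaBullet 5) ↔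
      ((α, β, g), t, q) ∈ quinticParams := by
  have h0 : 0 < q := by nlinarith [sq_nonneg t]
  have h1 : 0 < α * β * q * g := mul_pos (mul_pos (mul_pos hα (hα.trans hβ)) h0) hg
  rw [hasSignPattern_monicPoly_iff (by simp [sigmaBullet])]
  simp only [quinticParams, quinticCoeffs, sigmaBullet, Fin.forall_fin_succ, Set.mem_ofPred_eq]
  simp [hα, hβ, hg, hq, sign_pos h1, sign_eq_one_iff, sign_eq_neg_one_iff, -neg_sub]

lemma A_five_eq : A (sigmaBullet 5) 2 1 = quinticCoeffs '' quinticParams := by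
  ext a
  refine (mem_A_iff_quadratic (m := 1)).trans ⟨?_, ?_⟩
  · rintro ⟨hs, α, β, t, q, γ, h1, h2, h3, h4, -, hP⟩
    rw [Fin.prod_univ_one, ← monicPoly_quinticCoeffs] at hP
    have ha := monicPoly_injective hP
    rw [ha] at hs
    exact ⟨_, (hasSignPattern_quinticCoeffs h1 h2 (h4 0) h3).1 hs, ha.symm⟩
  · rintro ⟨⟨⟨α, β, g⟩, t, q⟩, hp, rfl⟩
    refine ⟨(hasSignPattern_quinticCoeffs hp.1.1 hp.1.2.1 hp.1.2.2 hp.2.1).2 hp, α, β, t, q,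
      fun _ => g, hp.1.1, hp.1.2.1, hp.2.1, fun _ => hp.1.2.2,
      Function.injective_of_subsingleton _, ?_⟩
    rw [Fin.prod_univ_one, ← monicPoly_quinticCoeffs]

/-- Over every choice of real roots the fibre contains `x ^ 2 - g x + g ^ 2`, the cofactor of
`x + g` in `x ^ 3 + g ^ 3`. -/
lemma mem_quinticParams {α β g : ℝ} (hα : 0 < α) (hβ : α < β) (hg : 0 < g) :
    ((α, β, g), g, g ^ 2) ∈ quinticParams := by
  have h2 := hα.trans hβ
  refine ⟨⟨hα, hβ, hg⟩, ?_, ?_, ?_, ?_, ?_⟩ <;> simp only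
  · nlinarith
  · have : 0 < (α + β) * g ^ 3 := by positivity
    linarith
  · have : 0 < g ^ 3 := by positivity
    linarith
  · have : 0 < α * β := by positivity
    linarith
  · linarith

lemma isPreconnected_quinticParams : IsPreconnected quinticParams := by
  refine isPreconnected_of_fibers ?_
    (B := {x : ℝ × ℝ × ℝ | 0 < x.1 ∧ x.1 < x.2.1 ∧ 0 < x.2.2}) ?_ ?_ fun x => ?_
  · unfold quinticParams
    refine ((?_ : IsOpen _).and <| IsOpen.and ?_ ?_).and <| IsOpen.and ?_ <| IsOpen.and ?_ <|
      IsOpen.and ?_ <| IsOpen.and ?_ ?_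
    all_goals exact isOpen_lt (by fun_prop) (by fun_prop)
  · have := (convex_setOf_pos_lt.prod (convex_Ioi (0 : ℝ))).isPreconnected.image
      (fun y => (y.1.1, y.1.2, y.2)) (Continuous.continuousOn (by fun_prop))
    convert this using 1
    ext ⟨x, y, w⟩
    simp [and_assoc]
  · ext x
    constructor
    · rintro ⟨p, hp, rfl⟩
      exact hp.1
    · intro hx
      exact ⟨_, mem_quinticParams hx.1 hx.2.1 hx.2.2, rfl⟩
  · by_cases hx : 0 < x.1 ∧ x.1 < x.2.1 ∧ 0 < x.2.2
    · obtain ⟨α, β, g⟩ := x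
      -- For fixed real roots every coefficient condition is affine in `y = (t, q)`; the half-planes
      -- list those of $x^1,\dots,x^4$ in this order.
      have h : {y | ((α, β, g), y) ∈ quinticParams} = {y | y.1 ^ 2 < 4 * y.2} ∩
          ({y | 0 < 0 + α * β * g * y.1 + ((α + β) * g - α * β) * y.2} ∩
          ({y | 0 < α * β * g + ((α + β) * g - α * β) * y.1 + (g - (α + β)) * y.2} ∩
          ({y | 0 < α * β - (α + β) * g + (α + β - g) * y.1 + 1 * y.2} ∩
          {y | 0 < α + β - g + 1 * y.1 + 0 * y.2}))) := by
        ext y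
        simp only at hx
        simp only [quinticParams, hx, Set.mem_ofPred_eq, Set.mem_inter_iff, true_and, and_self]
        ring_nf
      rw [h]
      exact (convex_parabola.inter <| (convex_halfPlane _ _ _).inter <|
        (convex_halfPlane _ _ _).inter <|
        (convex_halfPlane _ _ _).inter (convex_halfPlane _ _ _)).isPreconnected
    · convert isPreconnected_empty
      ext y
      simp only [quinticParams, hx, Set.mem_ofPred_eq, false_and, Set.mem_empty_iff_false]

theorem isConnected_A_five : IsConnected (A (sigmaBullet 5) 2 1) := by
  rw [A_five_eq]
  refine ⟨⟨_, _, mem_quinticParams one_pos one_lt_two one_pos, rfl⟩,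
    isPreconnected_quinticParams.image _ (Continuous.continuousOn ?_)⟩
  refine continuous_pi fun j => ?_
  fin_cases j <;> simp only [quinticCoeffs] <;> simp <;> fun_prop

end Quintic

end RealPoly

end

theorem theorem1 :
    (∀ d : ℕ, 6 ≤ d →
      (RealPoly.A (RealPoly.sigmaBullet d) 2 (d - 4)).Nonempty ∧
      (∃ K : Set (Set (Fin d → ℝ)), K ⊆ RealPoly.componentsOf (RealPoly.R3 d) ∧
        K.Nontrivial ∧ RealPoly.A (RealPoly.sigmaBullet d) 2 (d - 4) = ⋃₀ K) ∧
      ¬ IsConnected (RealPoly.A (RealPoly.sigmaBullet d) 2 (d - 4))) ∧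
    IsConnected (RealPoly.A (RealPoly.sigmaBullet 4) 2 0) ∧
    IsConnected (RealPoly.A (RealPoly.sigmaBullet 5) 2 1) := by
  refine ⟨fun d hd => ?_, RealPoly.isConnected_A_four, RealPoly.isConnected_A_five⟩
  obtain ⟨k, rfl⟩ : ∃ k, d = k + 2 + 4 := ⟨d - 6, by omega⟩
  obtain ⟨h₁, h₂⟩ := RealPoly.sideSet_sigmaBullet_nonempty (k + 2)
  rw [Nat.add_sub_cancel]
  exact ⟨h₁.mono RealPoly.sideSet_subset_A, RealPoly.A_eq_sUnion_components h₁ h₂⟩
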